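/- Let $R$ be a commutative noetherian local ring. An $R$-module $G$ is called totally reflexive if there is an exact complex $\mathbf F=\cdots\to F_{n+1}\to F_n\to F_{n-1}\to\cdots$ ($n\in\mathbb Z$) of finitely generated free $R$-modules such that the complex $\operatorname{Hom}_R(\mathbf F,R)$ is exact and $G$ is isomorphic to $\operatorname{Coker}(F_0\to F_{-1})$. If the set of isomorphism classes of indecomposable totally reflexive $R$-modules is finite, then $R$ is Gorenstein or the totally reflexive $R$-modules are exactly the finitely generated free $R$-modules. -/

import Mathlib

open CategoryTheory

/-- A module `M` over a commutative ring `R` is totally reflexive if there is an exact complex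
`⋯ → F (n + 1) → F n → F (n - 1) → ⋯` (indexed by all integers `n`) of finitely generated free
`R`-modules `F n = R ^ r n`, with differentials `d n : F (n + 1) → F n`, such that the dual
complex `Hom (F, R)` is exact as well and `M` is isomorphic to the cokernel of the differential
`F 0 → F (-1)`. Such a module is automatically finitely generated. -/
def IsTotallyReflexive (R : Type*) [CommRing R] (M : Type*) [AddCommGroup M] [Module R M] : Prop :=
  ∃ (r : ℤ → ℕ) (d : ∀ n : ℤ, (Fin (r (n + 1)) → R) →ₗ[R] (Fin (r n) → R)),
    (∀ n : ℤ, Function.Exact (d (n + 1)) (d n)) ∧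
    (∀ n : ℤ, Function.Exact (d n).dualMap (d (n + 1)).dualMap) ∧
    Nonempty (M ≃ₗ[R] ((Fin (r (-1)) → R) ⧸ LinearMap.range (d (-1))))

/-- A module is indecomposable if it is nonzero and is not the internal direct sum of two nonzero
submodules. -/
def IsIndecomposableModule (R : Type*) [CommRing R] (M : Type*) [AddCommGroup M] [Module R M] :
    Prop :=
  Nontrivial M ∧ ∀ A B : Submodule R M, IsCompl A B → A = ⊥ ∨ B = ⊥

universe u

/-- A noetherian local ring is Gorenstein if it has finite injective dimension as a module over
itself. -/
def IsGorensteinLocal (R : Type u) [CommRing R] [IsLocalRing R] [IsNoetherianRing R] : Prop :=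
  ∃ n : ℕ, HasInjectiveDimensionLE (ModuleCat.of R R) n

/-- The set of isomorphism classes of indecomposable totally reflexive `R`-modules. Totally
reflexive modules are finitely generated, so each of them has an isomorphic copy in the universe
of `R`. -/
def indecTotallyReflexiveClasses (R : Type u) [CommRing R] :
    Set (Quotient (isIsomorphicSetoid (ModuleCat.{u} R))) :=
  {c | ∃ M : ModuleCat.{u} R, IsTotallyReflexive R M ∧ IsIndecomposableModule R M ∧
    c = Quotient.mk (isIsomorphicSetoid (ModuleCat.{u} R)) M}

open Function

/-! Let `k` be the residue field and suppose that some totally reflexive `M` is not free. The goal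
is `Ext^i(k, R) = 0` for all large `i`, which makes `R` Gorenstein
(`isGorensteinLocal_of_ext_residueField`). Total reflexivity is used in the form
`IsGorensteinProjective`, which is easily seen to pass to retracts, extensions, duals and syzygies.

Finite type gives a precover `φ : B → k` (`exists_precover`). If `φ` were minimal, Wakamatsu's lemma
would give `Ext^1(X, ker φ) = 0` for all totally reflexive `X`. Without minimality the same pushout
argument still produces an endomorphism `θ` of `B` with `φ θ = φ` that annihilates these groups;
finite type, used again, makes one `θ` serve all `X` (`EndOver.exists_kills_all`).

Resolve `M` by free modules `F_j`; all syzygies are nonfree. Let `V_j` be the image of `Hom(F_j, B)`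
in `L_j = Hom(F_{j+1}, B)`, and `C_j = L_j / V_j`. The kernel of `C_j → V_{j+1}` is the cohomology
`H` of `Hom(F, B)`. By the choice of `θ`, its action on `H` factors through the image `U` of `H` in
the cohomology with coefficients in `k`; since `φ θ = φ`, the action of `θ` on `C_j` looks like the
identity on `U` plus `θ` on `V_{j+1}`. Nonfreeness of the syzygies makes `U` a nonzero `k`-vector
space. As `L_j` is a sum of copies of `B`, shifting degrees embeds the sum of `Ext^{j+2}(k, R)` and
the `θ`-fixed part of `Ext^{j+2}(V_{j+1}, R)` into the `θ`-fixed part of `Ext^{j+1}(V_j, R)`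
(`exists_fixed_shift_hom`). Iterating, the noetherian module `Ext^1(V_0, R)` contains the direct sum
of all `Ext^{j+2}(k, R)`, so almost all of these vanish
(`eventually_subsingleton_of_injective_chain`). -/

/-- The group `Ext^i(M, N)` of two modules. -/
noncomputable abbrev ModExt (R : Type u) [CommRing R] (M N : Type u) [AddCommGroup M] [Module R M]
    [AddCommGroup N] [Module R N] (i : ℕ) : Type u :=
  Abelian.Ext (ModuleCat.of R M) (ModuleCat.of R N) i

/-! ### Functoriality and long exact sequences of `Ext` in terms of linear maps. -/

namespace ModExt

variable {R : Type u} [CommRing R]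
  {M M' M'' N N' N'' A B C A' B' C' : Type u}
  [AddCommGroup M] [Module R M] [AddCommGroup M'] [Module R M'] [AddCommGroup M''] [Module R M'']
  [AddCommGroup N] [Module R N] [AddCommGroup N'] [Module R N'] [AddCommGroup N''] [Module R N'']
  [AddCommGroup A] [Module R A] [AddCommGroup A'] [Module R A']
  [AddCommGroup B] [Module R B] [AddCommGroup B'] [Module R B']
  [AddCommGroup C] [Module R C] [AddCommGroup C'] [Module R C']

/-- Contravariant functoriality of `Ext` in the first argument. -/
noncomputable def map (N : Type u) [AddCommGroup N] [Module R N] (f : M →ₗ[R] M') (i : ℕ) :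
    ModExt R M' N i →ₗ[R] ModExt R M N i :=
  (Abelian.Ext.mk₀ (ModuleCat.ofHom f)).precompOfLinear R _ (zero_add i)

/-- Covariant functoriality of `Ext` in the second argument. -/
noncomputable def mapRight (M : Type u) [AddCommGroup M] [Module R M] (f : N →ₗ[R] N') (i : ℕ) :
    ModExt R M N i →ₗ[R] ModExt R M N' i :=
  (Abelian.Ext.mk₀ (ModuleCat.ofHom f)).postcompOfLinear R _ (add_zero i)

lemma map_apply (f : M →ₗ[R] M') (i : ℕ) (e : ModExt R M' N i) :
    map N f i e = (Abelian.Ext.mk₀ (ModuleCat.ofHom f)).comp e (zero_add i) := rfl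

lemma mapRight_apply (f : N →ₗ[R] N') (i : ℕ) (e : ModExt R M N i) :
    mapRight M f i e = e.comp (Abelian.Ext.mk₀ (ModuleCat.ofHom f)) (add_zero i) := rfl

lemma map_id (i : ℕ) (e : ModExt R M N i) : map N (LinearMap.id : M →ₗ[R] M) i e = e := by
  rw [map_apply]; exact Abelian.Ext.mk₀_id_comp e

lemma map_comp (f : M →ₗ[R] M') (g : M' →ₗ[R] M'') (i : ℕ) (e : ModExt R M'' N i) :
    map N (g ∘ₗ f) i e = map N f i (map N g i e) := by
  simp only [map_apply]
  rw [ModuleCat.ofHom_comp, Abelian.Ext.mk₀_comp_mk₀_assoc]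

lemma mapRight_comp (f : N →ₗ[R] N') (g : N' →ₗ[R] N'') (i : ℕ) (e : ModExt R M N i) :
    mapRight M (g ∘ₗ f) i e = mapRight M g i (mapRight M f i e) := by
  simp only [mapRight_apply]
  rw [ModuleCat.ofHom_comp, Abelian.Ext.comp_assoc_of_second_deg_zero, Abelian.Ext.mk₀_comp_mk₀]

lemma map_zero' (i : ℕ) (e : ModExt R M' N i) : map N (0 : M →ₗ[R] M') i e = 0 := by
  rw [map_apply]
  have : (ModuleCat.ofHom (0 : M →ₗ[R] M')) = 0 := rfl
  rw [this, Abelian.Ext.mk₀_zero, Abelian.Ext.zero_comp]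

lemma map_add' (f g : M →ₗ[R] M') (i : ℕ) (e : ModExt R M' N i) :
    map N (f + g) i e = map N f i e + map N g i e := by
  simp only [map_apply]
  have : (ModuleCat.ofHom (f + g)) = ModuleCat.ofHom f + ModuleCat.ofHom g := rfl
  rw [this, Abelian.Ext.mk₀_add, Abelian.Ext.add_comp]

lemma map_smul_id (r : R) (i : ℕ) (e : ModExt R M N i) :
    map N (r • (LinearMap.id : M →ₗ[R] M)) i e = r • e := by
  rw [map_apply]
  have : (ModuleCat.ofHom (r • (LinearMap.id : M →ₗ[R] M))) = r • 𝟙 (ModuleCat.of R M) := rfl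
  rw [this, Abelian.Ext.mk₀_smul, Abelian.Ext.smul_comp, Abelian.Ext.mk₀_id_comp]

lemma map_mapRight (f : M →ₗ[R] M') (h : N →ₗ[R] N') (i : ℕ) (e : ModExt R M' N i) :
    map N' f i (mapRight M' h i e) = mapRight M h i (map N f i e) := by
  simp only [map_apply, mapRight_apply]
  rw [Abelian.Ext.comp_assoc_of_third_deg_zero]

/-- A linear map as an element of `Ext^0`. -/
noncomputable def ofLin (f : M →ₗ[R] N) : ModExt R M N 0 := Abelian.Ext.mk₀ (ModuleCat.ofHom f)

lemma ofLin_injective : Injective (ofLin : (M →ₗ[R] N) → ModExt R M N 0) := fun f g h => by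
  have := Abelian.Ext.mk₀_bijective _ _ |>.1 h
  exact congrArg ModuleCat.Hom.hom this

lemma ofLin_surjective : Surjective (ofLin : (M →ₗ[R] N) → ModExt R M N 0) := fun e => by
  obtain ⟨f, rfl⟩ := (Abelian.Ext.mk₀_bijective _ _).2 e
  exact ⟨f.hom, rfl⟩

lemma map_ofLin (f : M →ₗ[R] M') (g : M' →ₗ[R] N) : map N f 0 (ofLin g) = ofLin (g ∘ₗ f) := by
  rw [map_apply, ofLin, ofLin, Abelian.Ext.mk₀_comp_mk₀, ModuleCat.ofHom_comp]

lemma mapRight_ofLin (f : M →ₗ[R] N) (g : N →ₗ[R] N') :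
    mapRight M g 0 (ofLin f) = ofLin (g ∘ₗ f) := by
  rw [mapRight_apply, ofLin, ofLin, Abelian.Ext.mk₀_comp_mk₀, ModuleCat.ofHom_comp]

/-- The short complex attached to a pair of linear maps that form an exact sequence. -/
noncomputable def sc (f : A →ₗ[R] B) (g : B →ₗ[R] C) (h : Exact f g) :
    ShortComplex (ModuleCat.{u} R) :=
  ModuleCat.shortComplexOfCompEqZero f g h.linearMap_comp_eq_zero

lemma sc_shortExact {f : A →ₗ[R] B} {g : B →ₗ[R] C} (hf : Injective f) (h : Exact f g)
    (hg : Surjective g) : (sc f g h).ShortExact :=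
  ModuleCat.shortComplex_shortExact _ h hf hg

section connecting

variable {f : A →ₗ[R] B} {g : B →ₗ[R] C} (hf : Injective f) (h : Exact f g) (hg : Surjective g)

/-- The connecting homomorphism of the contravariant long exact sequence. -/
noncomputable def δ (N : Type u) [AddCommGroup N] [Module R N] (i : ℕ) :
    ModExt R A N i →ₗ[R] ModExt R C N (i + 1) :=
  (sc_shortExact hf h hg).extClass.precompOfLinear R (ModuleCat.of R N) (add_comm 1 i)

lemma exact_map_map {f : A →ₗ[R] B} {g : B →ₗ[R] C} (hf : Injective f) (h : Exact f g)
    (hg : Surjective g) (i : ℕ) : ∀ e : ModExt R B N i, map N f i e = 0 →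
    ∃ e', map N g i e' = e := fun e he =>
  Abelian.Ext.contravariant_sequence_exact₂ (sc_shortExact hf h hg) _ e he

lemma exact_map_δ (i : ℕ) : ∀ e : ModExt R A N i, δ hf h hg N i e = 0 →
    ∃ e', map N f i e' = e := fun e he =>
  Abelian.Ext.contravariant_sequence_exact₁ (sc_shortExact hf h hg) _ e (add_comm 1 i) he

lemma exact_δ_map (i : ℕ) : ∀ e : ModExt R C N (i + 1), map N g (i + 1) e = 0 →
    ∃ e', δ hf h hg N i e' = e := fun e he =>
  Abelian.Ext.contravariant_sequence_exact₃ (sc_shortExact hf h hg) _ e he (add_comm 1 i)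

lemma δ_map (i : ℕ) (e : ModExt R B N i) : δ hf h hg N i (map N f i e) = 0 :=
  (sc_shortExact hf h hg).extClass_comp_assoc (h := add_comm 1 i) e

lemma δ_mapRight (k : N →ₗ[R] N') (i : ℕ) (e : ModExt R A N i) :
    δ hf h hg N' i (mapRight A k i e) = mapRight C k (i + 1) (δ hf h hg N i e) := by
  symm
  exact Abelian.Ext.comp_assoc_of_third_deg_zero (sc_shortExact hf h hg).extClass e
    (Abelian.Ext.mk₀ (ModuleCat.ofHom k)) (add_comm 1 i)

lemma δ_naturality {f' : A' →ₗ[R] B'} {g' : B' →ₗ[R] C'} (hf' : Injective f') (h' : Exact f' g')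
    (hg' : Surjective g') (a : A →ₗ[R] A') (b : B →ₗ[R] B') (c : C →ₗ[R] C')
    (hab : b ∘ₗ f = f' ∘ₗ a) (hbc : c ∘ₗ g = g' ∘ₗ b) (i : ℕ) (e : ModExt R A' N i) :
    δ hf h hg N i (map N a i e) = map N c (i + 1) (δ hf' h' hg' N i e) := by
  let S := sc_shortExact hf h hg
  let S' := sc_shortExact hf' h' hg'
  let F : sc f g h ⟶ sc f' g' h' :=
    { τ₁ := ModuleCat.ofHom a
      τ₂ := ModuleCat.ofHom b
      τ₃ := ModuleCat.ofHom c
      comm₁₂ := ModuleCat.hom_ext hab.symm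
      comm₂₃ := ModuleCat.hom_ext hbc.symm }
  have key := ShortComplex.ShortExact.extClass_naturality S S' F
  have h1 := Abelian.Ext.comp_assoc S.extClass (Abelian.Ext.mk₀ F.τ₁) e (add_zero 1) (zero_add i)
    (by omega : 1 + 0 + i = i + 1)
  have h2 := Abelian.Ext.comp_assoc (Abelian.Ext.mk₀ F.τ₃) S'.extClass e (zero_add 1) (add_comm 1 i)
    (by omega : 0 + 1 + i = i + 1)
  refine Eq.trans h1.symm (Eq.trans ?_ h2)
  rw [key]

end connecting

lemma eq_zero_of_projective [Module.Projective R M] (i : ℕ) (e : ModExt R M N (i + 1)) : e = 0 :=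
  haveI : Projective (ModuleCat.of R M) := (IsProjective.iff_projective M).1 inferInstance
  Abelian.Ext.eq_zero_of_projective e

instance [IsNoetherianRing R] [Module.Finite R M] [Module.Finite R N] (i : ℕ) :
    Module.Finite R (ModExt R M N i) :=
  haveI : Module.Finite R (ModuleCat.of R M) := ‹_›
  haveI : Module.Finite R (ModuleCat.of R N) := ‹_›
  ModuleCat.finite_ext R _ _ i

lemma subsingleton_of_subsingleton [Subsingleton M] (i : ℕ) : Subsingleton (ModExt R M N i) := by
  refine ⟨fun a b => ?_⟩
  have h : (LinearMap.id : M →ₗ[R] M) = 0 := by ext x; exact Subsingleton.elim _ _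
  rw [← map_id i a, ← map_id i b, h, map_zero', map_zero']

lemma subsingleton_of_retract (s : M →ₗ[R] M') (r : M' →ₗ[R] M) (h : r ∘ₗ s = LinearMap.id) (i : ℕ)
    [Subsingleton (ModExt R M' N i)] : Subsingleton (ModExt R M N i) := by
  refine ⟨fun a b => ?_⟩
  rw [← map_id i a, ← map_id i b, ← h, map_comp, map_comp,
    Subsingleton.elim (map N r i a) (map N r i b)]

/-- A map that is killed by the connecting homomorphism extends. -/
lemma exists_extension {f : A →ₗ[R] B} {g : B →ₗ[R] C} (hf : Injective f) (h : Exact f g)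
    (hg : Surjective g) (k : A →ₗ[R] N) (hk : δ hf h hg N 0 (ofLin k) = 0) :
    ∃ l : B →ₗ[R] N, l ∘ₗ f = k := by
  obtain ⟨e, he⟩ := exact_map_δ hf h hg 0 _ hk
  obtain ⟨l, rfl⟩ := ofLin_surjective e
  rw [map_ofLin] at he
  exact ⟨l, ofLin_injective he⟩

lemma δ_ofLin_comp {f : A →ₗ[R] B} {g : B →ₗ[R] C} (hf : Injective f) (h : Exact f g)
    (hg : Surjective g) (l : B →ₗ[R] N) : δ hf h hg N 0 (ofLin (l ∘ₗ f)) = 0 := by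
  rw [← map_ofLin, δ_map]

end ModExt

/-! ### Modules with vanishing `Ext` into the ring, and modules of Gorenstein dimension zero. -/

/-- All higher `Ext^i(M, R)` vanish. -/
def ExtVanishing (R : Type u) [CommRing R] (M : Type u) [AddCommGroup M] [Module R M] : Prop :=
  ∀ i : ℕ, Subsingleton (ModExt R M R (i + 1))

section

variable {R : Type u} [CommRing R] {M A B C : Type u} [AddCommGroup M] [Module R M]
  [AddCommGroup A] [Module R A] [AddCommGroup B] [Module R B] [AddCommGroup C] [Module R C]

namespace ExtVanishing

lemma of_projective [Module.Projective R M] : ExtVanishing R M := fun i =>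
  ⟨fun a b => by rw [ModExt.eq_zero_of_projective i a, ModExt.eq_zero_of_projective i b]⟩

lemma of_retract (h : ExtVanishing R B) (s : A →ₗ[R] B) (r : B →ₗ[R] A)
    (hrs : r ∘ₗ s = LinearMap.id) : ExtVanishing R A := fun i =>
  have := h i
  ModExt.subsingleton_of_retract s r hrs (i + 1)

lemma of_equiv (h : ExtVanishing R B) (e : A ≃ₗ[R] B) : ExtVanishing R A :=
  h.of_retract e.toLinearMap e.symm.toLinearMap (by ext; simp)

variable {f : A →ₗ[R] B} {g : B →ₗ[R] C}

lemma left (hB : ExtVanishing R B) (hC : ExtVanishing R C) (hf : Injective f) (h : Exact f g)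
    (hg : Surjective g) : ExtVanishing R A := fun i => by
  refine subsingleton_of_forall_eq 0 fun e => ?_
  obtain ⟨e', rfl⟩ := ModExt.exact_map_δ hf h hg (i + 1) e
    ((hC (i + 1)).elim _ _)
  rw [(hB i).elim e' 0, map_zero]

lemma middle (hA : ExtVanishing R A) (hC : ExtVanishing R C) (hf : Injective f) (h : Exact f g)
    (hg : Surjective g) : ExtVanishing R B := fun i => by
  refine subsingleton_of_forall_eq 0 fun e => ?_
  obtain ⟨e', rfl⟩ := ModExt.exact_map_map hf h hg (i + 1) e ((hA i).elim _ _)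
  rw [(hC i).elim e' 0, map_zero]

/-- The long exact sequence leaves only `Ext^1(C, R)` open; it is the cokernel of `f.dualMap`, hence
the extra hypothesis `hd`. -/
lemma right (hA : ExtVanishing R A) (hB : ExtVanishing R B) (hf : Injective f) (h : Exact f g)
    (hg : Surjective g) (hd : Surjective f.dualMap) : ExtVanishing R C := fun i => by
  refine subsingleton_of_forall_eq 0 fun e => ?_
  obtain ⟨e', rfl⟩ := ModExt.exact_δ_map hf h hg i e ((hB i).elim _ _)
  cases i with
  | zero =>
    obtain ⟨k, rfl⟩ := ModExt.ofLin_surjective e'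
    obtain ⟨l, rfl⟩ := hd k
    exact ModExt.δ_ofLin_comp hf h hg l
  | succ i => rw [(hA i).elim e' 0, map_zero]

lemma dualMap_surjective (hC : ExtVanishing R C) (hf : Injective f) (h : Exact f g)
    (hg : Surjective g) : Surjective f.dualMap := fun k => by
  obtain ⟨l, hl⟩ := ModExt.exists_extension hf h hg k ((hC 0).elim _ _)
  exact ⟨l, hl⟩

lemma pi (hB : ExtVanishing R B) (n : ℕ) : ExtVanishing R (Fin n → B) := by
  induction n with
  | zero => exact fun i => ModExt.subsingleton_of_subsingleton (i + 1)
  | succ n ih =>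
    exact (ExtVanishing.middle hB ih (f := LinearMap.inl R B (Fin n → B))
      (g := LinearMap.snd R B (Fin n → B)) LinearMap.inl_injective Exact.inl_snd
      Prod.snd_surjective).of_equiv (Fin.consLinearEquiv R (fun _ => B)).symm

end ExtVanishing

lemma exists_comp_eq_of_ker_le {g : A →ₗ[R] B} (hg : Surjective g) {k : A →ₗ[R] C}
    (h : LinearMap.ker g ≤ LinearMap.ker k) : ∃ l : B →ₗ[R] C, l ∘ₗ g = k := by
  refine ⟨(LinearMap.ker g).liftQ k h ∘ₗ (g.quotKerEquivOfSurjective hg).symm.toLinearMap, ?_⟩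
  ext x
  have : (g.quotKerEquivOfSurjective hg).symm (g x) = (LinearMap.ker g).mkQ x := by
    rw [LinearEquiv.symm_apply_eq]; rfl
  simp [this]

lemma exact_dualMap {f : A →ₗ[R] B} {g : B →ₗ[R] C} (h : Exact f g) (hg : Surjective g) :
    Exact g.dualMap f.dualMap := by
  intro k
  constructor
  · intro hk
    refine exists_comp_eq_of_ker_le hg fun x hx => ?_
    obtain ⟨a, rfl⟩ := (h x).1 hx
    exact LinearMap.congr_fun hk a
  · rintro ⟨l, rfl⟩
    ext a
    simp [LinearMap.dualMap_apply, h.apply_apply_eq_zero a]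

lemma eval_natural (f : A →ₗ[R] B) (a : A) :
    f.dualMap.dualMap (Module.Dual.eval R A a) = Module.Dual.eval R B (f a) := rfl

/-- A finitely generated reflexive module `M` such that the higher `Ext`-modules of `M` and of its
dual into the ring vanish. -/
structure IsGorensteinProjective (R : Type u) [CommRing R] (M : Type u) [AddCommGroup M]
    [Module R M] : Prop where
  finite : Module.Finite R M
  reflexive : Module.IsReflexive R M
  ext : ExtVanishing R M
  ext_dual : ExtVanishing R (Module.Dual R M)

namespace IsGorensteinProjective

lemma of_free [Module.Finite R M] [Module.Free R M] : IsGorensteinProjective R M :=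
  ⟨‹_›, inferInstance, .of_projective, .of_projective⟩

lemma of_retract (h : IsGorensteinProjective R B) (s : A →ₗ[R] B) (r : B →ₗ[R] A)
    (hrs : r ∘ₗ s = LinearMap.id) : IsGorensteinProjective R A where
  finite := haveI := h.finite; Module.Finite.of_surjective r
    (fun a => ⟨s a, LinearMap.congr_fun hrs a⟩)
  reflexive := haveI := h.reflexive; Module.IsReflexive.of_split s r hrs
  ext := h.ext.of_retract s r hrs
  ext_dual := h.ext_dual.of_retract r.dualMap s.dualMap
    (by rw [LinearMap.dualMap_comp_dualMap, hrs, LinearMap.dualMap_id])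

lemma of_equiv (h : IsGorensteinProjective R B) (e : A ≃ₗ[R] B) : IsGorensteinProjective R A :=
  h.of_retract e.toLinearMap e.symm.toLinearMap (by ext; simp)

variable {f : A →ₗ[R] B} {g : B →ₗ[R] C}

/-- Since `Ext^1(C, R) = 0`, the dual sequence is short exact. Dualising again gives a left exact
sequence, and reflexivity of the middle term is a five lemma chase along the evaluation maps. -/
lemma extension (hA : IsGorensteinProjective R A) (hC : IsGorensteinProjective R C)
    (hf : Injective f) (h : Exact f g) (hg : Surjective g) : IsGorensteinProjective R B := by
  have hd := hC.ext.dualMap_surjective hf h hg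
  have hx := exact_dualMap (exact_dualMap h hg) hd
  have hi := LinearMap.dualMap_injective_of_surjective hd
  have := hA.finite
  have := hC.finite
  have := hA.reflexive
  have := hC.reflexive
  refine ⟨Module.Finite.of_exact h hg, ⟨⟨?_, ?_⟩⟩, hA.ext.middle hC.ext hf h hg,
    hC.ext_dual.middle hA.ext_dual (LinearMap.dualMap_injective_of_surjective hg)
      (exact_dualMap h hg) hd⟩
  · rw [injective_iff_map_eq_zero]
    intro b hb
    have hgb : g b = 0 := by
      apply (Module.bijective_dual_eval R C).1
      rw [← eval_natural, hb, map_zero, map_zero]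
    obtain ⟨a, rfl⟩ := (h b).1 hgb
    rw [← eval_natural] at hb
    have := (injective_iff_map_eq_zero _).1 hi _ hb
    rw [(injective_iff_map_eq_zero _).1 (Module.bijective_dual_eval R A).1 a this, map_zero]
  · intro b
    obtain ⟨c, hc⟩ := (Module.bijective_dual_eval R C).2 (g.dualMap.dualMap b)
    obtain ⟨b₀, rfl⟩ := hg c
    obtain ⟨a', ha'⟩ := (hx (b - Module.Dual.eval R B b₀)).1 (by
      rw [map_sub, eval_natural, hc, sub_self])
    obtain ⟨a, rfl⟩ := (Module.bijective_dual_eval R A).2 a'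
    refine ⟨f a + b₀, ?_⟩
    rw [map_add, ← eval_natural, ha', sub_add_cancel]

lemma prod (hA : IsGorensteinProjective R A) (hB : IsGorensteinProjective R B) :
    IsGorensteinProjective R (A × B) :=
  hA.extension hB (f := LinearMap.inl R A B) (g := LinearMap.snd R A B)
    LinearMap.inl_injective Exact.inl_snd Prod.snd_surjective

lemma left [IsNoetherianRing R] (hB : IsGorensteinProjective R B) (hC : IsGorensteinProjective R C)
    (hf : Injective f) (h : Exact f g) (hg : Surjective g) : IsGorensteinProjective R A := by
  have hd := hC.ext.dualMap_surjective hf h hg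
  have hi := LinearMap.dualMap_injective_of_surjective hd
  have := hB.finite
  have := hB.reflexive
  have := hC.reflexive
  refine ⟨Module.Finite.of_injective f hf, ⟨⟨?_, ?_⟩⟩, hB.ext.left hC.ext hf h hg,
    hC.ext_dual.right hB.ext_dual (LinearMap.dualMap_injective_of_surjective hg)
      (exact_dualMap h hg) hd ?_⟩
  · intro a b hab
    apply hf
    apply (Module.bijective_dual_eval R B).1
    rw [← eval_natural, hab, eval_natural]
  · intro a
    obtain ⟨b, hb⟩ := (Module.bijective_dual_eval R B).2 (f.dualMap.dualMap a)
    have hgb : g b = 0 := by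
      apply (Module.bijective_dual_eval R C).1
      rw [← eval_natural, hb, map_zero]
      exact (exact_dualMap (exact_dualMap h hg) hd).apply_apply_eq_zero a
    obtain ⟨a₀, rfl⟩ := (h b).1 hgb
    exact ⟨a₀, hi hb⟩
  -- By reflexivity, a functional on the dual of `C` is evaluation at some `c`; evaluation at a
  -- preimage of `c` in `B` extends it.
  · intro k
    obtain ⟨c, rfl⟩ := (Module.bijective_dual_eval R C).2 k
    obtain ⟨b, rfl⟩ := hg c
    exact ⟨Module.Dual.eval R B b, rfl⟩

lemma dual [IsNoetherianRing R] (hM : IsGorensteinProjective R M) :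
    IsGorensteinProjective R (Module.Dual R M) :=
  have := hM.finite
  have := hM.reflexive
  ⟨inferInstance, inferInstance, hM.ext_dual,
    hM.ext.of_equiv (Module.evalEquiv R M).symm⟩

lemma exists_syzygy [IsNoetherianRing R] (hM : IsGorensteinProjective R M) :
    ∃ (n : ℕ) (π : (Fin n → R) →ₗ[R] M), Surjective π ∧
      IsGorensteinProjective R (LinearMap.ker π) := by
  have := hM.finite
  obtain ⟨n, π, hπ⟩ := Module.Finite.exists_fin' R M
  exact ⟨n, π, hπ, left (B := Fin n → R) of_free hM (Submodule.injective_subtype _)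
    (LinearMap.exact_subtype_ker_map π) hπ⟩

/-- Dualise a syzygy sequence of the dual of `M` and identify the double dual with `M`. -/
lemma exists_cosyzygy [IsNoetherianRing R] (hM : IsGorensteinProjective R M) :
    ∃ (N : ModuleCat.{u} R) (n : ℕ) (ι : M →ₗ[R] (Fin n → R)) (π : (Fin n → R) →ₗ[R] N),
      IsGorensteinProjective R N ∧ Injective ι ∧ Exact ι π ∧ Surjective π := by
  obtain ⟨n, π, hπ, hK⟩ := hM.dual.exists_syzygy
  have hex := LinearMap.exact_subtype_ker_map π
  have hd := hM.dual.ext.dualMap_surjective (Submodule.injective_subtype _) hex hπ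
  have := hM.reflexive
  let e : Module.Dual R (Fin n → R) ≃ₗ[R] (Fin n → R) := ((Pi.basisFun R (Fin n)).toDualEquiv).symm
  let ε := Module.evalEquiv R M
  refine ⟨ModuleCat.of R (Module.Dual R (LinearMap.ker π)), n,
    e.toLinearMap ∘ₗ π.dualMap ∘ₗ ε.toLinearMap,
    (LinearMap.ker π).subtype.dualMap ∘ₗ e.symm.toLinearMap, hK.dual, ?_, ?_, ?_⟩
  · exact e.injective.comp ((LinearMap.dualMap_injective_of_surjective hπ).comp ε.injective)
  · intro x
    have := exact_dualMap hex hπ (e.symm x)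
    refine this.trans ⟨?_, ?_⟩
    · rintro ⟨y, hy⟩
      exact ⟨ε.symm y, by simp [hy]⟩
    · rintro ⟨y, hy⟩
      exact ⟨ε y, by simp [← hy]⟩
  · exact hd.comp e.symm.surjective

end IsGorensteinProjective

end

/-! ### Images in an exact complex of free modules with exact dual. -/

section complexes

variable {R : Type u} [CommRing R] {r : ℤ → ℕ}
  {d : ∀ n : ℤ, (Fin (r (n + 1)) → R) →ₗ[R] (Fin (r n) → R)}

lemma rangeRestrict_exact (hd : ∀ n : ℤ, Exact (d (n + 1)) (d n)) (n : ℤ) :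
    Exact (LinearMap.range (d (n + 1))).subtype (d n).rangeRestrict := by
  intro x
  have : (d n).rangeRestrict x = 0 ↔ d n x = 0 := by
    rw [← Subtype.coe_inj]; rfl
  rw [this, hd n x]
  simp

/-- A functional on the image, composed with `d n`, is a cocycle of the dual complex; exactness
there makes it a coboundary, which is the required extension. -/
lemma range_subtype_dualMap_surjective (hd : ∀ n : ℤ, Exact (d (n + 1)) (d n))
    (hd' : ∀ n : ℤ, Exact (d n).dualMap (d (n + 1)).dualMap) (n : ℤ) :
    Surjective (LinearMap.range (d n)).subtype.dualMap := by
  intro ψ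
  obtain ⟨χ, hχ⟩ := (hd' n (ψ ∘ₗ (d n).rangeRestrict)).1 (by
    ext x
    have h0 : (d n).rangeRestrict (d (n + 1) (Pi.single x 1)) = 0 :=
      Subtype.ext ((hd n).apply_apply_eq_zero _)
    simp [LinearMap.dualMap_apply, h0])
  refine ⟨χ, ?_⟩
  ext ⟨_, y, rfl⟩
  exact LinearMap.congr_fun hχ y

lemma extVanishing_range (hd : ∀ n : ℤ, Exact (d (n + 1)) (d n))
    (hd' : ∀ n : ℤ, Exact (d n).dualMap (d (n + 1)).dualMap) (n : ℤ) :
    ExtVanishing R (LinearMap.range (d n)) := by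
  intro i
  induction i generalizing n with
  | zero =>
    refine subsingleton_of_forall_eq 0 fun e => ?_
    obtain ⟨e', rfl⟩ := ModExt.exact_δ_map (Submodule.injective_subtype _)
      (rangeRestrict_exact hd n) (LinearMap.surjective_rangeRestrict _) 0 e
      (ModExt.eq_zero_of_projective _ _)
    obtain ⟨k, rfl⟩ := ModExt.ofLin_surjective e'
    obtain ⟨l, rfl⟩ := range_subtype_dualMap_surjective hd hd' (n + 1) k
    exact ModExt.δ_ofLin_comp _ _ _ l
  | succ i ih =>
    refine subsingleton_of_forall_eq 0 fun e => ?_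
    obtain ⟨e', rfl⟩ := ModExt.exact_δ_map (Submodule.injective_subtype _)
      (rangeRestrict_exact hd n) (LinearMap.surjective_rangeRestrict _) (i + 1) e
      (ModExt.eq_zero_of_projective _ _)
    rw [(ih (n + 1)).elim e' 0, map_zero]

lemma isReflexive_range (hd : ∀ n : ℤ, Exact (d (n + 1)) (d n))
    (hd' : ∀ n : ℤ, Exact (d n).dualMap (d (n + 1)).dualMap) (n : ℤ) :
    Module.IsReflexive R (LinearMap.range (d n)) := by
  -- After this shift the image in question is the kernel of `d n`, so membership can be tested on
  -- coordinates.
  obtain ⟨n, rfl⟩ : ∃ m, n = m + 1 := ⟨n - 1, by ring⟩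
  let ι := (LinearMap.range (d (n + 1))).subtype
  have hι := range_subtype_dualMap_surjective hd hd' (n + 1)
  refine ⟨⟨?_, ?_⟩⟩
  · intro a b hab
    apply Submodule.injective_subtype
    apply (Module.bijective_dual_eval R _).1
    rw [← eval_natural, hab, eval_natural]
  · intro ξ
    obtain ⟨x, hx⟩ := (Module.bijective_dual_eval R _).2 (ι.dualMap.dualMap ξ)
    have hx' : ∀ χ : Module.Dual R (Fin (r (n + 1)) → R), χ x = ξ (ι.dualMap χ) := fun χ =>
      LinearMap.congr_fun hx χ
    have h0 : d n x = 0 := by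
      ext i
      have := hx' (LinearMap.proj i ∘ₗ d n)
      have h1 : ι.dualMap (LinearMap.proj i ∘ₗ d n) = 0 := by
        ext ⟨_, y, rfl⟩
        simp [ι, LinearMap.dualMap_apply, (hd n).apply_apply_eq_zero y]
      rw [h1, map_zero] at this
      exact this
    obtain ⟨y, rfl⟩ := (hd n x).1 h0
    refine ⟨⟨_, y, rfl⟩, ?_⟩
    ext ψ
    obtain ⟨χ, rfl⟩ := hι ψ
    exact hx' χ

/-- The dualised short exact sequences shift degrees in the opposite direction. In degree one,
reflexivity turns the functional into evaluation at a point, which lifts to the free module. -/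
lemma extVanishing_dual_range (hd : ∀ n : ℤ, Exact (d (n + 1)) (d n))
    (hd' : ∀ n : ℤ, Exact (d n).dualMap (d (n + 1)).dualMap) (n : ℤ) :
    ExtVanishing R (Module.Dual R (LinearMap.range (d n))) := by
  intro i
  induction i generalizing n with
  | zero =>
    obtain ⟨n, rfl⟩ : ∃ m, n = m + 1 := ⟨n - 1, by ring⟩
    refine subsingleton_of_forall_eq 0 fun e => ?_
    have hs := (d n).surjective_rangeRestrict
    have hex := rangeRestrict_exact hd n
    obtain ⟨e', rfl⟩ := ModExt.exact_δ_map (LinearMap.dualMap_injective_of_surjective hs)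
      (exact_dualMap hex hs) (range_subtype_dualMap_surjective hd hd' (n + 1)) 0 e
      (ModExt.eq_zero_of_projective _ _)
    obtain ⟨k, rfl⟩ := ModExt.ofLin_surjective e'
    obtain ⟨z, rfl⟩ := (isReflexive_range hd hd' n).bijective_dual_eval'.2 k
    obtain ⟨x, rfl⟩ := hs z
    exact ModExt.δ_ofLin_comp _ _ _ (Module.Dual.eval R _ x)
  | succ i ih =>
    obtain ⟨n, rfl⟩ : ∃ m, n = m + 1 := ⟨n - 1, by ring⟩
    refine subsingleton_of_forall_eq 0 fun e => ?_
    have hs := (d n).surjective_rangeRestrict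
    have hex := rangeRestrict_exact hd n
    obtain ⟨e', rfl⟩ := ModExt.exact_δ_map (LinearMap.dualMap_injective_of_surjective hs)
      (exact_dualMap hex hs) (range_subtype_dualMap_surjective hd hd' (n + 1)) (i + 1) e
      (ModExt.eq_zero_of_projective _ _)
    rw [(ih n).elim e' 0, map_zero]

end complexes

/-! ### Equivalence of the two descriptions of total reflexivity. -/

section

variable {R : Type u} [CommRing R]

lemma IsTotallyReflexive.isGorensteinProjective {M : Type u} [AddCommGroup M] [Module R M]
    (h : IsTotallyReflexive R M) : IsGorensteinProjective R M := by
  obtain ⟨r, d, hd, hd', ⟨e⟩⟩ := h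
  have key (n m : ℤ) (hm : m = n + 1)
      (e : M ≃ₗ[R] ((Fin (r m) → R) ⧸ LinearMap.range (d m))) : IsGorensteinProjective R M := by
    subst hm
    have hn : IsGorensteinProjective R (LinearMap.range (d n)) :=
      ⟨inferInstance, isReflexive_range hd hd' _, extVanishing_range hd hd' _,
        extVanishing_dual_range hd hd' _⟩
    exact hn.of_equiv (e.trans ((Submodule.quotEquivOfEq _ _
      (LinearMap.exact_iff.1 (hd n)).symm).trans (d n).quotKerEquivRange))
  -- The cokernel of `d (-1)` is the image of `d (-2)`.
  exact key (-2) (-1) (by norm_num) e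

/-- The module `N` is a syzygy of the module `M`. -/
def IsSyzygy (R : Type u) [CommRing R] (N M : Type u) [AddCommGroup N] [Module R N]
    [AddCommGroup M] [Module R M] : Prop :=
  ∃ (n : ℕ) (ι : N →ₗ[R] (Fin n → R)) (π : (Fin n → R) →ₗ[R] M),
    Injective ι ∧ Exact ι π ∧ Surjective π

lemma exists_int_chain {S : Type*} {rel : S → S → Prop} (h₁ : ∀ s, ∃ t, rel t s)
    (h₂ : ∀ s, ∃ t, rel s t) (s₀ : S) :
    ∃ X : ℤ → S, X (-1) = s₀ ∧ ∀ n, rel (X (n + 1)) (X n) := by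
  choose f hf using h₁
  choose g hg using h₂
  let X : ℤ → S := fun n => match n with
    | Int.ofNat k => f^[k + 1] s₀
    | Int.negSucc k => g^[k] s₀
  refine ⟨X, rfl, fun n => ?_⟩
  match n with
  | Int.ofNat k =>
    change rel (f^[k + 1 + 1] s₀) (f^[k + 1] s₀)
    rw [iterate_succ_apply' f (k + 1)]
    exact hf _
  | Int.negSucc 0 => exact hf s₀
  | Int.negSucc (k + 1) =>
    have : Int.negSucc (k + 1) + 1 = Int.negSucc k := by omega
    rw [this]
    change rel (g^[k] s₀) (g^[k + 1] s₀)
    rw [iterate_succ_apply']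
    exact hg _

/-- Syzygies and cosyzygies of `M` are again of this kind, so the short exact sequences splice in
both directions. The dual complex is exact because every cosyzygy has `Ext^1` into `R` equal to
zero. -/
lemma IsGorensteinProjective.isTotallyReflexive [IsNoetherianRing R] {M : Type u} [AddCommGroup M]
    [Module R M] (hM : IsGorensteinProjective R M) : IsTotallyReflexive R M := by
  let S := {N : ModuleCat.{u} R // IsGorensteinProjective R N}
  obtain ⟨X, hX₀, hX⟩ := exists_int_chain (S := S) (rel := fun N M => IsSyzygy R N.1 M.1)
    (fun s => by
      obtain ⟨n, π, hπ, hK⟩ := s.2.exists_syzygy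
      exact ⟨⟨ModuleCat.of R (LinearMap.ker π), hK⟩, n, (LinearMap.ker π).subtype, π,
        Submodule.injective_subtype _, LinearMap.exact_subtype_ker_map π, hπ⟩)
    (fun s => by
      obtain ⟨N, n, ι, π, hN, h⟩ := s.2.exists_cosyzygy
      exact ⟨⟨N, hN⟩, n, ι, π, h⟩) ⟨ModuleCat.of R M, hM⟩
  choose r ι π hι hex hπ using hX
  refine ⟨r, fun n => ι n ∘ₗ π (n + 1), fun n x => ?_, fun n φ => ?_, ?_⟩
  · simp only [LinearMap.comp_apply]
    rw [map_eq_zero_iff _ (hι n), hex (n + 1) x]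
    constructor
    · rintro ⟨y, rfl⟩
      obtain ⟨w, rfl⟩ := hπ (n + 1 + 1) y
      exact ⟨w, rfl⟩
    · rintro ⟨w, rfl⟩
      exact ⟨_, rfl⟩
  · constructor
    · intro h
      have h1 : (ι (n + 1)).dualMap φ = 0 := by
        ext y
        obtain ⟨w, rfl⟩ := hπ (n + 1 + 1) y
        exact LinearMap.congr_fun h w
      obtain ⟨ψ, rfl⟩ := (exact_dualMap (hex (n + 1)) (hπ (n + 1)) φ).1 h1
      obtain ⟨χ, rfl⟩ := (X n).2.ext.dualMap_surjective (hι n) (hex n) (hπ n) ψ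
      exact ⟨χ, rfl⟩
    · rintro ⟨χ, rfl⟩
      ext x
      simp [LinearMap.dualMap_apply, (hex (n + 1)).apply_apply_eq_zero]
  · have hr : LinearMap.range (ι (-1) ∘ₗ π (-1 + 1)) = LinearMap.ker (π (-1)) := by
      rw [LinearMap.range_comp_of_range_eq_top _ (LinearMap.range_eq_top.2 (hπ (-1 + 1)))]
      exact (LinearMap.exact_iff.1 (hex (-1))).symm
    have e := (Submodule.quotEquivOfEq _ _ hr).trans ((π (-1)).quotKerEquivOfSurjective (hπ (-1)))
    rw [hX₀] at e
    exact ⟨e.symm⟩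

end

/-! ### Finite injective dimension from vanishing `Ext` on the residue field. -/

section

variable {R : Type u} [CommRing R]

lemma exact_smul_factor (I : Ideal R) (x : R) :
    Exact (x • (LinearMap.id : (R ⧸ I) →ₗ[R] (R ⧸ I)))
      (Submodule.factor (le_sup_left : I ≤ I ⊔ Ideal.span {x})) := by
  intro y
  obtain ⟨y, rfl⟩ := Submodule.mkQ_surjective I y
  change Submodule.Quotient.mk (p := I ⊔ Ideal.span {x}) y = 0 ↔ _
  rw [Submodule.Quotient.mk_eq_zero]
  constructor
  · intro hy
    obtain ⟨a, ha, z, hz, rfl⟩ := Submodule.mem_sup.1 hy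
    obtain ⟨b, rfl⟩ := Ideal.mem_span_singleton'.1 hz
    refine ⟨Submodule.Quotient.mk b, ?_⟩
    change Submodule.Quotient.mk (p := I) (x • b) = Submodule.Quotient.mk (a + b * x)
    rw [Submodule.Quotient.eq]
    have : x • b - (a + b * x) = -a := by simp; ring
    rw [this]
    exact neg_mem ha
  · rintro ⟨b, hb⟩
    obtain ⟨b, rfl⟩ := Submodule.mkQ_surjective I b
    replace hb : Submodule.Quotient.mk (p := I) (x • b) = Submodule.Quotient.mk y := hb
    rw [Submodule.Quotient.eq] at hb
    have : y = -(x • b - y) + b * x := by simp; ring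
    rw [this]
    exact add_mem (Ideal.mem_sup_left (neg_mem hb))
      (Ideal.mem_sup_right (Ideal.mul_mem_left _ _ (Ideal.mem_span_singleton_self x)))

/-- Vanishing of `Ext^i(-, N)` on the residue field for all large `i` propagates to all cyclic
modules. -/
lemma subsingleton_ext_quotient [IsLocalRing R] [IsNoetherianRing R] {N : Type u} [AddCommGroup N]
    [Module R N] [Module.Finite R N] {n : ℕ}
    (h : ∀ i, n ≤ i → Subsingleton (ModExt R (R ⧸ IsLocalRing.maximalIdeal R) N i))
    (I : Ideal R) : ∀ i, n ≤ i → Subsingleton (ModExt R (R ⧸ I) N i) := by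
  induction I using WellFoundedGT.induction with
  | ind I ih =>
  intro i hi
  by_cases htop : I = ⊤
  · have : Subsingleton (R ⧸ I) := Submodule.Quotient.subsingleton_iff.2 htop
    exact ModExt.subsingleton_of_subsingleton i
  by_cases hmax : I = IsLocalRing.maximalIdeal R
  · rw [hmax]
    exact h i hi
  obtain ⟨x, hxm, hxI⟩ := SetLike.exists_of_lt
    (lt_of_le_of_ne (IsLocalRing.le_maximalIdeal htop) hmax)
  have hsup : I < I ⊔ Ideal.span {x} :=
    lt_of_le_of_ne le_sup_left fun hI => hxI (hI ▸ Ideal.mem_sup_right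
      (Ideal.mem_span_singleton_self x))
  let μ : (R ⧸ I) →ₗ[R] (R ⧸ I) := x • LinearMap.id
  have hex : Exact μ (Submodule.factor (le_sup_left : I ≤ I ⊔ Ideal.span {x})) :=
    exact_smul_factor I x
  have hsurj := Submodule.factor_surjective (le_sup_left : I ≤ I ⊔ Ideal.span {x})
  by_cases hμ : Injective μ
  -- If `x` is regular on `R ⧸ I`, the long exact sequence makes `x` act surjectively on this
  -- finitely generated module, and Nakayama's lemma applies.
  · have hE : (⊤ : Submodule R (ModExt R (R ⧸ I) N i)) = ⊥ := by
      refine Submodule.eq_bot_of_le_smul_of_le_jacobson_bot (IsLocalRing.maximalIdeal R) _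
        Module.Finite.fg_top (fun e _ => ?_) (IsLocalRing.jacobson_eq_maximalIdeal ⊥ bot_ne_top).ge
      obtain ⟨e', rfl⟩ := ModExt.exact_map_δ hμ hex hsurj i e
        ((ih _ hsup (i + 1) (by omega)).elim _ _)
      rw [ModExt.map_smul_id]
      exact Submodule.smul_mem_smul hxm trivial
    exact (Submodule.subsingleton_iff R).1 (subsingleton_of_bot_eq_top hE.symm)
  -- Otherwise the colon ideal `J = (I : x)` is strictly larger than `I`, and `R ⧸ I` is an
  -- extension of `R ⧸ (I + (x))` by `R ⧸ J`; both ends are covered by noetherian induction.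
  · let J : Ideal R := LinearMap.ker (μ ∘ₗ I.mkQ)
    have hIJ : I ≤ J := fun y hy => by
      have : I.mkQ y = 0 := (Submodule.Quotient.mk_eq_zero I).2 hy
      simp [J, this]
    have hJ : I < J := by
      refine lt_of_le_of_ne hIJ fun hJ => hμ ?_
      rw [injective_iff_map_eq_zero]
      intro y hy
      obtain ⟨y, rfl⟩ := Submodule.mkQ_surjective I y
      have : y ∈ J := hy
      rw [← hJ] at this
      exact (Submodule.Quotient.mk_eq_zero I).2 this
    let ν : (R ⧸ J) →ₗ[R] (R ⧸ I) := J.liftQ (μ ∘ₗ I.mkQ) le_rfl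
    have hν : Injective ν := LinearMap.ker_eq_bot.1 (Submodule.ker_liftQ_eq_bot' _ _ rfl)
    have hex' : Exact ν (Submodule.factor (le_sup_left : I ≤ I ⊔ Ideal.span {x})) := by
      intro y
      rw [hex y]
      constructor
      · rintro ⟨b, rfl⟩
        obtain ⟨b, rfl⟩ := Submodule.mkQ_surjective I b
        exact ⟨J.mkQ b, rfl⟩
      · rintro ⟨b, rfl⟩
        obtain ⟨b, rfl⟩ := Submodule.mkQ_surjective J b
        exact ⟨I.mkQ b, rfl⟩
    refine subsingleton_of_forall_eq 0 fun e => ?_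
    obtain ⟨e', rfl⟩ := ModExt.exact_map_map hν hex' hsurj i e ((ih _ hJ i hi).elim _ _)
    rw [(ih _ hsup i hi).elim e' 0, map_zero]

/-- A version of Baer's criterion for finite injective dimension. -/
lemma hasInjectiveDimensionLE_of_ext_quotient (n : ℕ) (N : ModuleCat.{u} R)
    (h : ∀ I : Ideal R, Subsingleton (ModExt R (R ⧸ I) N (n + 1))) :
    HasInjectiveDimensionLE N n := by
  induction n generalizing N with
  | zero =>
    have hB : Module.Baer R N := fun I g => by
      obtain ⟨l, hl⟩ := ModExt.exists_extension (Submodule.injective_subtype I)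
        (LinearMap.exact_subtype_mkQ I) (Submodule.mkQ_surjective I) g ((h I).elim _ _)
      exact ⟨l, fun x hx => LinearMap.congr_fun hl ⟨x, hx⟩⟩
    have : Injective (ModuleCat.of R N) :=
      (Module.injective_iff_injective_object R N).1 hB.injective
    have : Injective N := this
    exact inferInstanceAs (HasInjectiveDimensionLT N 1)
  | succ n ih =>
    -- Dimension shift: embed `N` in an injective module and treat the cokernel.
    let S : ShortComplex (ModuleCat.{u} R) := ShortComplex.mk (Injective.ι N)
      (Limits.cokernel.π (Injective.ι N)) (by simp)
    have hS : S.ShortExact :=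
      { exact := ShortComplex.exact_cokernel _
        mono_f := inferInstanceAs (Mono (Injective.ι N))
        epi_g := inferInstanceAs (Epi (Limits.cokernel.π (Injective.ι N))) }
    have hinj : Injective S.X₂ := inferInstanceAs (Injective (Injective.under N))
    refine (hS.hasInjectiveDimensionLT_X₃_iff n hinj).1 (ih S.X₃ fun I => ?_)
    refine subsingleton_of_forall_eq 0 fun e => ?_
    obtain ⟨e', rfl⟩ := Abelian.Ext.covariant_sequence_exact₃ _ hS e rfl ((h I).elim _ _)
    rw [Abelian.Ext.eq_zero_of_injective e', Abelian.Ext.zero_comp]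

lemma isGorensteinLocal_of_ext_residueField [IsLocalRing R] [IsNoetherianRing R] {n : ℕ}
    (h : ∀ i, n ≤ i → Subsingleton (ModExt R (R ⧸ IsLocalRing.maximalIdeal R) R i)) :
    IsGorensteinLocal R :=
  ⟨n, hasInjectiveDimensionLE_of_ext_quotient n _ fun I =>
    subsingleton_ext_quotient h I (n + 1) (by omega)⟩

end

/-! ### Precovers from finite representation type. -/

section

variable {R : Type u} [CommRing R]

/-- A property of modules that is invariant under isomorphism, stable under finite direct sums and
holds for the indecomposable modules satisfying `IsGorensteinProjective` holds for all of them. -/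
theorem IsGorensteinProjective.induction [IsLocalRing R]
    (P : ∀ (X : Type u) [AddCommGroup X] [Module R X], Prop)
    (zero : ∀ (X : Type u) [AddCommGroup X] [Module R X] [Subsingleton X], P X)
    (equiv : ∀ (X Y : Type u) [AddCommGroup X] [Module R X] [AddCommGroup Y] [Module R Y],
      (X ≃ₗ[R] Y) → P X → P Y)
    (prod : ∀ (X Y : Type u) [AddCommGroup X] [Module R X] [AddCommGroup Y] [Module R Y],
      P X → P Y → P (X × Y))
    (indec : ∀ (X : Type u) [AddCommGroup X] [Module R X], IsGorensteinProjective R X →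
      IsIndecomposableModule R X → P X)
    (X : Type u) [AddCommGroup X] [Module R X] (hX : IsGorensteinProjective R X) : P X := by
  let k := IsLocalRing.ResidueField R
  -- The induction runs on the dimension of the reduction modulo the maximal ideal: additive on
  -- direct sums and, by Nakayama's lemma, positive on nonzero finitely generated modules.
  suffices H : ∀ (n : ℕ) (X : Type u) [AddCommGroup X] [Module R X], IsGorensteinProjective R X →
      Module.finrank k (TensorProduct R k X) ≤ n → P X from H _ X hX le_rfl
  have pos : ∀ (X : Type u) [AddCommGroup X] [Module R X] [Module.Finite R X] [Nontrivial X],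
      0 < Module.finrank k (TensorProduct R k X) := by
    intro X _ _ _ _
    have : Nontrivial (TensorProduct R k X) := by
      by_contra h
      rw [not_nontrivial_iff_subsingleton] at h
      exact not_subsingleton X (IsLocalRing.subsingleton_tensorProduct.1 h)
    exact Module.finrank_pos
  intro n
  induction n with
  | zero =>
    intro X _ _ hX hn
    have := hX.finite
    rcases subsingleton_or_nontrivial X with h | h
    · exact zero X
    · have := pos X
      omega
  | succ n ih =>
    intro X _ _ hX hn
    have := hX.finite
    rcases subsingleton_or_nontrivial X with h | h
    · exact zero X
    by_cases hi : IsIndecomposableModule R X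
    · exact indec X hX hi
    · simp only [IsIndecomposableModule, not_and, not_forall, not_or] at hi
      obtain ⟨A, B, hAB, hA, hB⟩ := hi h
      let e := Submodule.prodEquivOfIsCompl A B hAB
      have hGA : IsGorensteinProjective R A := hX.of_retract A.subtype
        (LinearMap.fst R A B ∘ₗ e.symm.toLinearMap) (by ext x; simp [e])
      have hGB : IsGorensteinProjective R B := hX.of_retract B.subtype
        (LinearMap.snd R A B ∘ₗ e.symm.toLinearMap) (by ext x; simp [e])
      have := hGA.finite
      have := hGB.finite
      have := Submodule.nontrivial_iff_ne_bot.2 hA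
      have := Submodule.nontrivial_iff_ne_bot.2 hB
      have hrank : Module.finrank k (TensorProduct R k A) + Module.finrank k (TensorProduct R k B) =
          Module.finrank k (TensorProduct R k X) := by
        rw [← Module.finrank_prod, ← (TensorProduct.prodRight R k k A B).finrank_eq]
        exact (e.baseChange R k _ _).finrank_eq
      have hpA := pos A
      have hpB := pos B
      exact equiv _ _ e (prod A B (ih A hGA (by omega)) (ih B hGB (by omega)))

lemma exists_finite_representatives [IsNoetherianRing R]
    (hfin : (indecTotallyReflexiveClasses R).Finite) :
    ∃ S : Set (ModuleCat.{u} R), S.Finite ∧ (∀ X ∈ S, IsGorensteinProjective R X) ∧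
      ∀ (X : Type u) [AddCommGroup X] [Module R X], IsGorensteinProjective R X →
        IsIndecomposableModule R X → ∃ Y ∈ S, Nonempty (Y ≃ₗ[R] X) := by
  have out_equiv (M : ModuleCat.{u} R) :
      Nonempty ((Quotient.mk (isIsomorphicSetoid (ModuleCat.{u} R)) M).out ≃ₗ[R] M) := by
    obtain ⟨e⟩ := Quotient.mk_out (s := isIsomorphicSetoid (ModuleCat.{u} R)) M
    exact ⟨e.toLinearEquiv⟩
  refine ⟨Quotient.out '' indecTotallyReflexiveClasses R, hfin.image _, ?_, ?_⟩
  · rintro _ ⟨_, ⟨M, hM, -, rfl⟩, rfl⟩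
    obtain ⟨e⟩ := out_equiv M
    exact hM.isGorensteinProjective.of_equiv e
  · intro X _ _ hX hi
    exact ⟨_, ⟨_, ⟨ModuleCat.of R X, hX.isTotallyReflexive, hi, rfl⟩, rfl⟩,
      out_equiv (ModuleCat.of R X)⟩

/-- The map `φ : B → k` is a precover: all maps to `k` from finitely generated modules of
Gorenstein dimension zero factor through it. -/
def IsPrecover {B k : Type u} [AddCommGroup B] [Module R B] [AddCommGroup k] [Module R k]
    (φ : B →ₗ[R] k) : Prop :=
  ∀ (X : Type u) [AddCommGroup X] [Module R X], IsGorensteinProjective R X →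
    ∀ f : X →ₗ[R] k, ∃ g : X →ₗ[R] B, φ ∘ₗ g = f

lemma exists_dominating_map {k : Type u} [AddCommGroup k] [Module R k]
    {T : Set (Σ X : ModuleCat.{u} R, X →ₗ[R] k)} (hT : T.Finite)
    (hTG : ∀ t ∈ T, IsGorensteinProjective R t.1) :
    ∃ (B : ModuleCat.{u} R) (φ : B →ₗ[R] k), IsGorensteinProjective R B ∧
      ∀ t ∈ T, ∃ g : t.1 →ₗ[R] B, φ ∘ₗ g = t.2 := by
  induction T, hT using Set.Finite.induction_on with
  | empty => exact ⟨ModuleCat.of R R, 0, .of_free, by simp⟩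
  | @insert t T _ _ ih =>
    obtain ⟨B, φ, hB, h⟩ := ih fun s hs => hTG s (Set.mem_insert_of_mem _ hs)
    refine ⟨ModuleCat.of R (B × t.1), φ.coprod t.2, hB.prod (hTG t (Set.mem_insert _ _)), ?_⟩
    rintro s (rfl | hs)
    · exact ⟨LinearMap.inr R B s.1, LinearMap.coprod_inr _ _⟩
    · obtain ⟨g, hg⟩ := h s hs
      exact ⟨LinearMap.inl R B t.1 ∘ₗ g, by rw [← LinearMap.comp_assoc, LinearMap.coprod_inl, hg]⟩

/-- Take the sum of finitely many maps: for each representative `X` of the indecomposables, a finite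
generating set of `Hom(X, k)`. -/
theorem exists_precover [IsLocalRing R] [IsNoetherianRing R]
    (hfin : (indecTotallyReflexiveClasses R).Finite) (k : Type u) [AddCommGroup k] [Module R k]
    [Module.Finite R k] :
    ∃ (B : ModuleCat.{u} R) (φ : B →ₗ[R] k), IsGorensteinProjective R B ∧ IsPrecover φ := by
  obtain ⟨S, hS, hSG, hSX⟩ := exists_finite_representatives hfin
  have hgen (X : ModuleCat.{u} R) : ∃ t : Set (X →ₗ[R] k), t.Finite ∧
      (IsGorensteinProjective R X → Submodule.span R t = ⊤) := by
    by_cases hX : IsGorensteinProjective R X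
    · have := hX.finite
      obtain ⟨t, ht⟩ := Module.Finite.fg_top (R := R) (M := X →ₗ[R] k)
      exact ⟨t, t.finite_toSet, fun _ => ht⟩
    · exact ⟨∅, Set.finite_empty, fun h => (hX h).elim⟩
  choose t ht ht' using hgen
  obtain ⟨B, φ, hB, hφ⟩ := exists_dominating_map (k := k) (T := ⋃ X ∈ S, Sigma.mk X '' t X)
    (hS.biUnion fun X _ => (ht X).image _) (by
      intro s hs
      simp only [Set.mem_iUnion] at hs
      obtain ⟨X, hX, f, -, rfl⟩ := hs
      exact hSG X hX)
  refine ⟨B, φ, hB, fun X _ _ hX => ?_⟩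
  refine IsGorensteinProjective.induction
    (fun X _ _ => ∀ f : X →ₗ[R] k, ∃ g : X →ₗ[R] B, φ ∘ₗ g = f) ?_ ?_ ?_ ?_ X hX
  · intro X _ _ _ f
    exact ⟨0, by ext x; rw [Subsingleton.elim x 0, map_zero, map_zero]⟩
  · intro X Y _ _ _ _ e h f
    obtain ⟨g, hg⟩ := h (f ∘ₗ e.toLinearMap)
    refine ⟨g ∘ₗ e.symm.toLinearMap, ?_⟩
    rw [← LinearMap.comp_assoc, hg]
    ext; simp
  · intro X Y _ _ _ _ hX hY f
    obtain ⟨g, hg⟩ := hX (f ∘ₗ LinearMap.inl R X Y)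
    obtain ⟨g', hg'⟩ := hY (f ∘ₗ LinearMap.inr R X Y)
    refine ⟨g.coprod g', ?_⟩
    rw [LinearMap.comp_coprod, hg, hg', ← LinearMap.comp_coprod, LinearMap.coprod_inl_inr,
      LinearMap.comp_id]
  · intro X _ _ hX hi f
    obtain ⟨Y, hY, ⟨e⟩⟩ := hSX X hX hi
    have key : ∀ f : Y →ₗ[R] k, ∃ g : Y →ₗ[R] B, φ ∘ₗ g = f := by
      intro f
      have hf : f ∈ Submodule.span R (t Y) := by rw [ht' Y (hSG Y hY)]; trivial
      induction hf using Submodule.span_induction with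
      | mem f hf => exact hφ ⟨Y, f⟩ (Set.mem_biUnion hY ⟨f, hf, rfl⟩)
      | zero => exact ⟨0, LinearMap.comp_zero _⟩
      | add f f' _ _ h h' =>
        obtain ⟨g, rfl⟩ := h
        obtain ⟨g', rfl⟩ := h'
        exact ⟨g + g', LinearMap.comp_add _ _ _⟩
      | smul a f _ h =>
        obtain ⟨g, rfl⟩ := h
        exact ⟨a • g, LinearMap.comp_smul _ _ _⟩
    obtain ⟨g, hg⟩ := key (f ∘ₗ e.toLinearMap)
    refine ⟨g ∘ₗ e.symm.toLinearMap, ?_⟩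
    rw [← LinearMap.comp_assoc, hg]
    ext; simp

/-! ### Wakamatsu's lemma without minimality. -/

/-- Endomorphisms of `B` over `k`. -/
def EndOver {B k : Type u} [AddCommGroup B] [Module R B] [AddCommGroup k] [Module R k]
    (φ : B →ₗ[R] k) : Type u := {θ : B →ₗ[R] B // φ ∘ₗ θ = φ}

namespace EndOver

variable {B k : Type u} [AddCommGroup B] [Module R B] [AddCommGroup k] [Module R k]
  {φ : B →ₗ[R] k}

/-- The endomorphism of the kernel induced by an endomorphism over `k`. -/
def onKer (θ : EndOver φ) : LinearMap.ker φ →ₗ[R] LinearMap.ker φ :=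
  θ.1.restrict fun x hx => by
    rw [LinearMap.mem_ker] at hx ⊢
    rw [← hx]
    exact LinearMap.congr_fun θ.2 x

/-- Composition of endomorphisms over `k`. -/
def comp (θ θ' : EndOver φ) : EndOver φ :=
  ⟨θ.1 ∘ₗ θ'.1, by rw [← LinearMap.comp_assoc, θ.2, θ'.2]⟩

lemma onKer_comp (θ θ' : EndOver φ) : (θ.comp θ').onKer = θ.onKer ∘ₗ θ'.onKer := rfl

/-- The endomorphism `θ` over `k` annihilates `Ext^1(X, ker φ)`. -/
def Kills (θ : EndOver φ) (X : Type u) [AddCommGroup X] [Module R X] : Prop :=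
  ∀ e : ModExt R X (LinearMap.ker φ) 1, ModExt.mapRight X θ.onKer 1 e = 0

/-- A version of Wakamatsu's lemma for precovers that need not be minimal. -/
lemma exists_kills_element [IsNoetherianRing R] (hφ : IsPrecover φ) (hB : IsGorensteinProjective R B)
    {X : Type u} [AddCommGroup X] [Module R X] (hX : IsGorensteinProjective R X)
    (e : ModExt R X (LinearMap.ker φ) 1) :
    ∃ θ : EndOver φ, ModExt.mapRight X θ.onKer 1 e = 0 := by
  obtain ⟨n, π, hπ, -⟩ := hX.exists_syzygy
  let i := (LinearMap.ker π).subtype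
  have hi : Injective i := Submodule.injective_subtype _
  have hex : Exact i π := LinearMap.exact_subtype_ker_map π
  obtain ⟨e', rfl⟩ := ModExt.exact_δ_map hi hex hπ 0 e (ModExt.eq_zero_of_projective _ _)
  obtain ⟨f, rfl⟩ := ModExt.ofLin_surjective e'
  let f' : LinearMap.ker π →ₗ[R] B := (LinearMap.ker φ).subtype ∘ₗ f
  -- The quotient by `W` is the pushout of the syzygy sequence of `X` along `f'`: an extension of
  -- `X` by `B`, hence again of Gorenstein dimension zero.
  let W := LinearMap.range (f'.prod (-i))
  let b : B →ₗ[R] (B × (Fin n → R)) ⧸ W := W.mkQ ∘ₗ LinearMap.inl R _ _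
  let c : (B × (Fin n → R)) ⧸ W →ₗ[R] X := W.liftQ (π ∘ₗ LinearMap.snd R _ _) (by
    rintro _ ⟨x, rfl⟩
    simp [i])
  have hW (x : LinearMap.ker π) : W.mkQ (f' x, 0) = W.mkQ (0, i x) := by
    rw [← sub_eq_zero, ← map_sub, Submodule.mkQ_apply, Submodule.Quotient.mk_eq_zero]
    exact ⟨x, by simp⟩
  have hGE : IsGorensteinProjective R ((B × (Fin n → R)) ⧸ W) := by
    refine hB.extension hX (f := b) (g := c) ?_ ?_ ?_
    · rw [injective_iff_map_eq_zero]
      intro y hy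
      obtain ⟨x, hx⟩ := (Submodule.Quotient.mk_eq_zero W).1 hy
      have h2 : -i x = 0 := congrArg Prod.snd hx
      have h1 : f' x = y := congrArg Prod.fst hx
      have : x = 0 := hi (by rw [map_zero]; exact neg_eq_zero.1 h2)
      rw [← h1, this, map_zero]
    · intro y
      obtain ⟨⟨y, p⟩, rfl⟩ := W.mkQ_surjective y
      constructor
      · intro hy
        obtain ⟨x, rfl⟩ := (hex p).1 hy
        refine ⟨y + f' x, ?_⟩
        change W.mkQ (y + f' x, 0) = _
        have : (y + f' x, (0 : Fin n → R)) = (y, 0) + (f' x, 0) := by simp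
        rw [this, map_add, hW, ← map_add]
        simp
      · rintro ⟨z, hz⟩
        rw [← hz]
        simp [b, c]
    · intro x
      obtain ⟨p, rfl⟩ := hπ x
      exact ⟨W.mkQ (0, p), rfl⟩
  -- The map that is `φ` on `B` and zero on the free summand lifts through the precover. Restricting
  -- the lift `G` to `B` gives `θ`; restricting it to the free module extends `θ.onKer ∘ₗ f`, so the
  -- class of the latter vanishes.
  obtain ⟨G, hG⟩ := hφ _ hGE (W.liftQ (φ ∘ₗ LinearMap.fst R _ _) (by
    rintro _ ⟨x, rfl⟩
    simp [f']))
  have hG' (y : B) (p : Fin n → R) : φ (G (W.mkQ (y, p))) = φ y := LinearMap.congr_fun hG _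
  let θ : EndOver φ := ⟨G ∘ₗ b, by ext y; exact hG' y 0⟩
  let g : (Fin n → R) →ₗ[R] LinearMap.ker φ :=
    (G ∘ₗ W.mkQ ∘ₗ LinearMap.inr R _ _).codRestrict _ fun p => by
      rw [LinearMap.mem_ker]
      exact (hG' 0 p).trans (map_zero _)
  have hθ : θ.onKer ∘ₗ f = g ∘ₗ i := by
    ext x
    exact congrArg G (hW x)
  refine ⟨θ, ?_⟩
  rw [← ModExt.δ_mapRight, ModExt.mapRight_ofLin, hθ, ModExt.δ_ofLin_comp]

lemma exists_kills [IsNoetherianRing R] (hφ : IsPrecover φ) (hB : IsGorensteinProjective R B)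
    {X : Type u} [AddCommGroup X] [Module R X] (hX : IsGorensteinProjective R X) :
    ∃ θ : EndOver φ, θ.Kills X := by
  have key (t : Finset (ModExt R X (LinearMap.ker φ) 1)) :
      ∃ θ : EndOver φ, ∀ e ∈ t, ModExt.mapRight X θ.onKer 1 e = 0 := by
    classical
    induction t using Finset.induction_on with
    | empty => exact ⟨⟨LinearMap.id, LinearMap.comp_id _⟩, by simp⟩
    | insert a t _ ih =>
      obtain ⟨θ, hθ⟩ := ih
      -- Kill the image of `a` under `θ`, not `a` itself: the composite then kills `a` and
      -- everything already killed by `θ`.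
      obtain ⟨θ', hθ'⟩ := exists_kills_element hφ hB hX (ModExt.mapRight X θ.onKer 1 a)
      refine ⟨θ'.comp θ, fun e he => ?_⟩
      rw [onKer_comp, ModExt.mapRight_comp]
      rcases Finset.mem_insert.1 he with rfl | he
      · exact hθ'
      · rw [hθ e he, map_zero]
  have := hX.finite
  have := hB.finite
  obtain ⟨t, ht⟩ := Module.Finite.fg_top (R := R) (M := ModExt R X (LinearMap.ker φ) 1)
  obtain ⟨θ, hθ⟩ := key t
  refine ⟨θ, fun e => ?_⟩
  have : (⊤ : Submodule R (ModExt R X (LinearMap.ker φ) 1)) ≤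
      LinearMap.ker (ModExt.mapRight X θ.onKer 1) := by
    rw [← ht, Submodule.span_le]
    exact hθ
  exact this trivial

lemma Kills.of_retract {θ : EndOver φ} {X Y : Type u} [AddCommGroup X] [Module R X]
    [AddCommGroup Y] [Module R Y] (h : θ.Kills Y) (s : X →ₗ[R] Y) (r : Y →ₗ[R] X)
    (hrs : r ∘ₗ s = LinearMap.id) : θ.Kills X := fun e => by
  rw [← ModExt.map_id 1 e, ← hrs, ModExt.map_comp, ← ModExt.map_mapRight, h, map_zero]

lemma exists_kills_finite [IsNoetherianRing R] (hφ : IsPrecover φ) (hB : IsGorensteinProjective R B)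
    {S : Set (ModuleCat.{u} R)} (hS : S.Finite) (hSG : ∀ X ∈ S, IsGorensteinProjective R X) :
    ∃ θ : EndOver φ, ∀ X ∈ S, θ.Kills X := by
  induction S, hS using Set.Finite.induction_on with
  | empty => exact ⟨⟨LinearMap.id, LinearMap.comp_id _⟩, by simp⟩
  | @insert Y T _ _ ih =>
    obtain ⟨θ, hθ⟩ := ih fun X hX => hSG X (Set.mem_insert_of_mem _ hX)
    obtain ⟨θ', hθ'⟩ := exists_kills hφ hB (hSG Y (Set.mem_insert _ _))
    refine ⟨θ'.comp θ, fun X hX e => ?_⟩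
    rw [onKer_comp, ModExt.mapRight_comp]
    rcases hX with rfl | hX
    · exact hθ' _
    · rw [hθ X hX, map_zero]

lemma exists_kills_all [IsLocalRing R] [IsNoetherianRing R]
    (hfin : (indecTotallyReflexiveClasses R).Finite) (hφ : IsPrecover φ)
    (hB : IsGorensteinProjective R B) :
    ∃ θ : EndOver φ, ∀ (X : Type u) [AddCommGroup X] [Module R X], IsGorensteinProjective R X →
      θ.Kills X := by
  obtain ⟨S, hS, hSG, hSX⟩ := exists_finite_representatives hfin
  obtain ⟨θ, hθ⟩ := exists_kills_finite hφ hB hS hSG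
  refine ⟨θ, fun X _ _ hX => ?_⟩
  refine IsGorensteinProjective.induction (fun X _ _ => θ.Kills X) ?_ ?_ ?_ ?_ X hX
  · intro X _ _ _ e
    exact (ModExt.subsingleton_of_subsingleton 1).elim _ _
  · intro X Y _ _ _ _ e h
    exact h.of_retract e.symm.toLinearMap e.toLinearMap (by ext; simp)
  · intro X Y _ _ _ _ hX hY e
    have h1 : (LinearMap.inl R X Y ∘ₗ LinearMap.fst R X Y + LinearMap.inr R X Y ∘ₗ
        LinearMap.snd R X Y) = LinearMap.id := by
      ext <;> simp
    rw [← ModExt.map_id 1 e, ← h1, ModExt.map_add', ModExt.map_comp, ModExt.map_comp, map_add,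
      ← ModExt.map_mapRight (LinearMap.fst R X Y), ← ModExt.map_mapRight (LinearMap.snd R X Y),
      hX, hY, map_zero, map_zero, add_zero]
  · intro X _ _ hX hi
    obtain ⟨Y, hY, ⟨e⟩⟩ := hSX X hX hi
    exact (hθ Y hY).of_retract e.symm.toLinearMap e.toLinearMap (by ext; simp)

end EndOver

end

/-! ### Dimension shifting on fixed parts of `Ext`. -/

section

variable {R : Type u} [CommRing R]

/-- Let `F 0 ← F 1 ← F 2 ← ⋯` be maps of modules with `F 0` noetherian, and let `s j : S j → F j` be
maps such that the sum of `T j` and `s j` is injective. Then almost all `S j` vanish. -/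
lemma eventually_subsingleton_of_injective_chain (F S : ℕ → Type u) [∀ j, AddCommGroup (F j)]
    [∀ j, Module R (F j)] [∀ j, AddCommGroup (S j)] [∀ j, Module R (S j)] [IsNoetherian R (F 0)]
    (T : ∀ j, F (j + 1) →ₗ[R] F j) (s : ∀ j, S j →ₗ[R] F j)
    (h : ∀ j a x, T j a = s j x → a = 0 ∧ x = 0) :
    ∃ n, ∀ j, n ≤ j → Subsingleton (S j) := by
  let ψ : ∀ j, F j →ₗ[R] F 0 := fun j => Nat.rec LinearMap.id (fun j g => g ∘ₗ T j) j
  have hψs (j : ℕ) : ψ (j + 1) = ψ j ∘ₗ T j := rfl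
  have hψ (j : ℕ) : Injective (ψ j) := by
    induction j with
    | zero => exact injective_id
    | succ j ih =>
      rw [hψs, injective_iff_map_eq_zero]
      intro a ha
      refine (h j a 0 ?_).1
      rw [map_zero]
      exact (injective_iff_map_eq_zero _).1 ih _ ha
  let A : ℕ → Submodule R (F 0) := fun j => LinearMap.range (ψ j ∘ₗ s j)
  have hA (j : ℕ) : A j ≤ LinearMap.range (ψ j) := LinearMap.range_comp_le_range _ _
  have hstep (j : ℕ) : Disjoint (A j) (LinearMap.range (ψ (j + 1))) := by
    rw [Submodule.disjoint_def]
    rintro _ ⟨x, rfl⟩ ⟨a, ha⟩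
    have := (h j a x (hψ j ha)).2
    rw [this, map_zero]
  have hmono (j : ℕ) : LinearMap.range (ψ (j + 1)) ≤ LinearMap.range (ψ j) :=
    LinearMap.range_comp_le_range _ _
  have hdis (n : ℕ) : Disjoint (partialSups A n) (LinearMap.range (ψ (n + 1))) := by
    induction n with
    | zero => rw [partialSups_zero]; exact hstep 0
    | succ n ih =>
      rw [partialSups_add_one, Submodule.disjoint_def]
      intro x hx hx'
      obtain ⟨y, hy, z, hz, rfl⟩ := Submodule.mem_sup.1 hx
      have hy0 : y = 0 := by
        refine Submodule.disjoint_def.1 ih y hy ?_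
        rw [← add_sub_cancel_right y z]
        exact sub_mem (hmono _ hx') (hA _ hz)
      rw [hy0, zero_add] at hx' ⊢
      exact Submodule.disjoint_def.1 (hstep (n + 1)) z hz hx'
  -- The images `A j` form an independent sequence of submodules of the noetherian module `F 0`.
  obtain ⟨n, hn⟩ := IsNoetherian.disjoint_partialSups_eventually_bot A
    fun n => (hdis n).mono_right (hA _)
  refine ⟨n, fun j hj => subsingleton_of_forall_eq 0 fun x => ?_⟩
  have h0 : ψ j (s j x) = 0 := by
    have : ψ j (s j x) ∈ A j := ⟨x, rfl⟩
    rwa [hn j hj] at this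
  have h1 := (injective_iff_map_eq_zero _).1 (hψ j) _ h0
  exact (h j 0 x (by rw [h1, map_zero])).2

/-- The elements of `Ext^i(V, R)` that are fixed by an endomorphism of `V`. -/
noncomputable def ModExt.fixed {V : Type u} [AddCommGroup V] [Module R V] (θ : V →ₗ[R] V) (i : ℕ) :
    Submodule R (ModExt R V R i) := LinearMap.ker (ModExt.map R θ i - LinearMap.id)

lemma ModExt.mem_fixed {V : Type u} [AddCommGroup V] [Module R V] {θ : V →ₗ[R] V} {i : ℕ}
    {e : ModExt R V R i} : e ∈ ModExt.fixed θ i ↔ ModExt.map R θ i e = e := by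
  simp [ModExt.fixed, sub_eq_zero]

/-- Dimension shift along `0 → V → L → C → 0`, where `C` is, up to the action of an endomorphism,
a direct sum of `U` and `V'`. -/
lemma exists_fixed_shift {V L C V' U : Type u} [AddCommGroup V] [Module R V] [AddCommGroup L]
    [Module R L] [AddCommGroup C] [Module R C] [AddCommGroup V'] [Module R V'] [AddCommGroup U]
    [Module R U] {ι : V →ₗ[R] L} {q : L →ₗ[R] C} (hι : Injective ι) (hex : Exact ι q)
    (hq : Surjective q) (hL : ExtVanishing R L) {θV : V →ₗ[R] V} {θL : L →ₗ[R] L} {θC : C →ₗ[R] C}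
    {θV' : V' →ₗ[R] V'} (h₁ : θL ∘ₗ ι = ι ∘ₗ θV) (h₂ : θC ∘ₗ q = q ∘ₗ θL)
    {v : C →ₗ[R] V'} (hv : Surjective v) (h₃ : θV' ∘ₗ v = v ∘ₗ θC) {p : C →ₗ[R] U} {σ : U →ₗ[R] C}
    {ω : V' →ₗ[R] C} (hp : p ∘ₗ θC = p) (hpσ : p ∘ₗ σ = LinearMap.id) (hvσ : v ∘ₗ σ = 0)
    (hθ : θC = σ ∘ₗ p + ω ∘ₗ v) (i : ℕ) :
    ∃ (T : ModExt.fixed θV' (i + 2) →ₗ[R] ModExt.fixed θV (i + 1))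
      (s : ModExt R U R (i + 2) →ₗ[R] ModExt.fixed θV (i + 1)),
      ∀ a x, T a = s x → a = 0 ∧ x = 0 := by
  let D := ModExt.δ hι hex hq R (i + 1)
  have hD : Bijective D := by
    refine ⟨(injective_iff_map_eq_zero _).2 fun e he => ?_, fun e => ?_⟩
    · obtain ⟨e', rfl⟩ := ModExt.exact_map_δ hι hex hq (i + 1) e he
      rw [(hL i).elim e' 0, map_zero]
    · exact ModExt.exact_δ_map hι hex hq (i + 1) e ((hL (i + 1)).elim _ _)
  let E := LinearEquiv.ofBijective D hD
  have hnat (e : ModExt R V R (i + 1)) :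
      E (ModExt.map R θV (i + 1) e) = ModExt.map R θC (i + 2) (E e) :=
    ModExt.δ_naturality hι hex hq hι hex hq θV θL θC h₁ h₂ (i + 1) e
  have hfix (c : ModExt R C R (i + 2)) (hc : ModExt.map R θC (i + 2) c = c) :
      E.symm c ∈ ModExt.fixed θV (i + 1) := by
    rw [ModExt.mem_fixed]
    apply E.injective
    rw [hnat, E.apply_symm_apply, hc]
  -- Hence on fixed classes pullback along `ω` inverts pullback along `v`, which is therefore
  -- injective there.
  have hvω : v ∘ₗ ω = θV' := by
    have : (v ∘ₗ ω) ∘ₗ v = θV' ∘ₗ v := by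
      rw [h₃, hθ, LinearMap.comp_add, ← LinearMap.comp_assoc, ← LinearMap.comp_assoc, hvσ,
        LinearMap.zero_comp, zero_add]
    ext x
    obtain ⟨y, rfl⟩ := hv x
    exact LinearMap.congr_fun this y
  let T : ModExt.fixed θV' (i + 2) →ₗ[R] ModExt.fixed θV (i + 1) :=
    (E.symm.toLinearMap ∘ₗ ModExt.map R v (i + 2) ∘ₗ Submodule.subtype _).codRestrict _
      fun a => hfix _ (by
        simp only [LinearMap.comp_apply, Submodule.subtype_apply]
        rw [← ModExt.map_comp, ← h₃, ModExt.map_comp, ModExt.mem_fixed.1 a.2])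
  let s : ModExt R U R (i + 2) →ₗ[R] ModExt.fixed θV (i + 1) :=
    (E.symm.toLinearMap ∘ₗ ModExt.map R p (i + 2)).codRestrict _
      fun x => hfix _ (by
        rw [← ModExt.map_comp, hp])
  refine ⟨T, s, fun a x hax => ?_⟩
  have hvp : ModExt.map R v (i + 2) a = ModExt.map R p (i + 2) x :=
    E.symm.injective (congrArg Subtype.val hax)
  -- Pulling back along `σ` recovers `x` from the `p` side and gives zero on the `v` side.
  have hx : x = 0 := by
    rw [← ModExt.map_id (i + 2) x, ← hpσ, ModExt.map_comp, ← hvp, ← ModExt.map_comp, hvσ,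
      ModExt.map_zero']
  refine ⟨Subtype.ext ?_, hx⟩
  rw [hx, map_zero] at hvp
  calc (a : ModExt R V' R (i + 2)) = ModExt.map R (v ∘ₗ ω) (i + 2) a := by
        rw [hvω, ModExt.mem_fixed.1 a.2]
    _ = 0 := by rw [ModExt.map_comp, hvp, map_zero]

/-- Post-composition with a linear map. -/
def postcomp (P : Type u) [AddCommGroup P] [Module R P] {B B' : Type u} [AddCommGroup B]
    [Module R B] [AddCommGroup B'] [Module R B'] (θ : B →ₗ[R] B') :
    (P →ₗ[R] B) →ₗ[R] (P →ₗ[R] B') where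
  toFun f := θ ∘ₗ f
  map_add' f g := LinearMap.comp_add f g θ
  map_smul' a f := LinearMap.comp_smul θ a f

/-- Pre-composition with a linear map. -/
def precomp {P P' : Type u} [AddCommGroup P] [Module R P] [AddCommGroup P'] [Module R P']
    (B : Type u) [AddCommGroup B] [Module R B] (d : P' →ₗ[R] P) :
    (P →ₗ[R] B) →ₗ[R] (P' →ₗ[R] B) where
  toFun f := f ∘ₗ d
  map_add' f g := LinearMap.add_comp d g f
  map_smul' a f := LinearMap.smul_comp a f d

/-- The action of an endomorphism of `B` on the image of `Hom(P, B) → Hom(P', B)`. -/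
def rangeEnd {P P' B : Type u} [AddCommGroup P] [Module R P] [AddCommGroup P'] [Module R P']
    [AddCommGroup B] [Module R B] (d : P' →ₗ[R] P) (θ : B →ₗ[R] B) :
    LinearMap.range (precomp B d) →ₗ[R] LinearMap.range (precomp B d) :=
  (postcomp P' θ).restrict (by
    rintro _ ⟨f, rfl⟩
    exact ⟨θ ∘ₗ f, rfl⟩)

end

section

variable {R : Type u} [CommRing R] [IsLocalRing R]

lemma isSimpleModule_quotient_maximalIdeal : IsSimpleModule R (R ⧸ IsLocalRing.maximalIdeal R) :=
  isSimpleModule_iff_quot_maximal.2 ⟨_, inferInstance, ⟨LinearEquiv.refl R _⟩⟩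

/-- A nonzero semisimple module that is killed by the maximal ideal has the residue field as a
direct summand. -/
lemma exists_residueField_retract {U : Type u} [AddCommGroup U] [Module R U] [IsSemisimpleModule R U]
    [Nontrivial U] (hU : ∀ a ∈ IsLocalRing.maximalIdeal R, ∀ x : U, a • x = 0) :
    ∃ (s : (R ⧸ IsLocalRing.maximalIdeal R) →ₗ[R] U) (r : U →ₗ[R] (R ⧸ IsLocalRing.maximalIdeal R)),
      r ∘ₗ s = LinearMap.id := by
  have := isSimpleModule_quotient_maximalIdeal (R := R)
  obtain ⟨x, hx⟩ := exists_ne (0 : U)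
  let s : (R ⧸ IsLocalRing.maximalIdeal R) →ₗ[R] U :=
    (IsLocalRing.maximalIdeal R).liftQ (LinearMap.toSpanSingleton R U x) fun a ha => hU a ha x
  have hs : Injective s := by
    refine (LinearMap.injective_or_eq_zero s).resolve_right fun h => hx ?_
    have : s (Submodule.Quotient.mk 1) = x := one_smul R x
    rw [← this, h, LinearMap.zero_apply]
  obtain ⟨r, hr⟩ := IsSemisimpleModule.extension_property s hs LinearMap.id
  exact ⟨s, r, hr⟩

/-- The dimension shift for the complex `Hom(P, B)`, where `B` is a precover of the residue field. -/
lemma exists_fixed_shift_hom {P₀ P₂ B : Type u} {n : ℕ} [AddCommGroup P₀] [Module R P₀]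
    [AddCommGroup P₂] [Module R P₂] [AddCommGroup B] [Module R B]
    {d₀ : (Fin n → R) →ₗ[R] P₀} {d₁ : P₂ →ₗ[R] (Fin n → R)} (hd : d₀ ∘ₗ d₁ = 0)
    {φ : B →ₗ[R] (R ⧸ IsLocalRing.maximalIdeal R)} (θ : EndOver φ)
    (hL : ExtVanishing R ((Fin n → R) →ₗ[R] B))
    (h₁ : ∀ f : (Fin n → R) →ₗ[R] B, f ∘ₗ d₁ = 0 →
      (∃ h : P₀ →ₗ[R] (R ⧸ IsLocalRing.maximalIdeal R), φ ∘ₗ f = h ∘ₗ d₀) →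
      ∃ g : P₀ →ₗ[R] B, θ.1 ∘ₗ f = g ∘ₗ d₀)
    (h₂ : ∃ f : (Fin n → R) →ₗ[R] B, f ∘ₗ d₁ = 0 ∧
      ¬ ∃ h : P₀ →ₗ[R] (R ⧸ IsLocalRing.maximalIdeal R), φ ∘ₗ f = h ∘ₗ d₀) (i : ℕ) :
    ∃ (T : ModExt.fixed (rangeEnd d₁ θ.1) (i + 2) →ₗ[R] ModExt.fixed (rangeEnd d₀ θ.1) (i + 1))
      (s : ModExt R (R ⧸ IsLocalRing.maximalIdeal R) R (i + 2) →ₗ[R]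
        ModExt.fixed (rangeEnd d₀ θ.1) (i + 1)),
      ∀ a x, T a = s x → a = 0 ∧ x = 0 := by
  let k := R ⧸ IsLocalRing.maximalIdeal R
  let L := (Fin n → R) →ₗ[R] B
  let Lk := (Fin n → R) →ₗ[R] k
  let V := LinearMap.range (precomp B d₀)
  let V' := LinearMap.range (precomp B d₁)
  let Vk := LinearMap.range (precomp k d₀)
  have hVθ : V ≤ V.comap (postcomp (Fin n → R) θ.1) := by
    rintro _ ⟨g, rfl⟩
    exact ⟨θ.1 ∘ₗ g, rfl⟩
  have hVφ : V ≤ Vk.comap (postcomp (Fin n → R) φ) := by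
    rintro _ ⟨g, rfl⟩
    exact ⟨φ ∘ₗ g, rfl⟩
  let θC : (L ⧸ V) →ₗ[R] (L ⧸ V) := V.mapQ V (postcomp (Fin n → R) θ.1) hVθ
  let φC : (L ⧸ V) →ₗ[R] (Lk ⧸ Vk) := V.mapQ Vk (postcomp (Fin n → R) φ) hVφ
  have hφθ : φC ∘ₗ θC = φC := by
    ext1
    ext1 f
    change Vk.mkQ (φ ∘ₗ θ.1 ∘ₗ f) = Vk.mkQ (φ ∘ₗ f)
    rw [← LinearMap.comp_assoc, θ.2]
  let v : (L ⧸ V) →ₗ[R] V' := V.liftQ (precomp B d₁).rangeRestrict (by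
    rintro _ ⟨g, rfl⟩
    rw [LinearMap.mem_ker]
    refine Subtype.ext ?_
    change (g ∘ₗ d₀) ∘ₗ d₁ = 0
    rw [LinearMap.comp_assoc, hd, LinearMap.comp_zero])
  have hv : Surjective v := by
    rintro ⟨_, g, rfl⟩
    exact ⟨V.mkQ g, rfl⟩
  have hv0 (f : L) : v (V.mkQ f) = 0 ↔ f ∘ₗ d₁ = 0 := Subtype.ext_iff
  have hvθ : rangeEnd d₁ θ.1 ∘ₗ v = v ∘ₗ θC := by
    ext1
    rfl
  have hφ0 (f : L) : φC (V.mkQ f) = 0 ↔ ∃ h : P₀ →ₗ[R] k, φ ∘ₗ f = h ∘ₗ d₀ := by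
    change Vk.mkQ (φ ∘ₗ f) = 0 ↔ _
    rw [Submodule.mkQ_apply, Submodule.Quotient.mk_eq_zero]
    exact ⟨fun ⟨h, hh⟩ => ⟨h, hh.symm⟩, fun ⟨h, hh⟩ => ⟨h, hh.symm⟩⟩
  -- `H` consists of cocycles modulo the image `V`, and `U` is its image after passing to
  -- coefficients in `k`, where everything is semisimple.
  let H := LinearMap.ker v
  let U := H.map φC
  have := isSimpleModule_quotient_maximalIdeal (R := R)
  have hk : IsSemisimpleModule R Lk :=
    IsSemisimpleModule.congr ((Pi.basisFun R (Fin n)).constr R (M' := k)).symm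
  obtain ⟨ρ, hρ⟩ := IsSemisimpleModule.extension_property U.subtype (Submodule.injective_subtype U)
    LinearMap.id
  let p : (L ⧸ V) →ₗ[R] U := ρ ∘ₗ φC
  let ε : H →ₗ[R] U := φC.restrict fun x hx => Submodule.mem_map_of_mem hx
  have hε : Surjective ε := by
    rintro ⟨_, x, hx, rfl⟩
    exact ⟨⟨x, hx⟩, rfl⟩
  -- This is where `h₁` enters: `θ` annihilates the classes that die in `k`-cohomology, so its
  -- action on `H` descends to `σ` on `U`.
  have hker : LinearMap.ker ε ≤ LinearMap.ker (θC ∘ₗ H.subtype) := by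
    rintro ⟨x, hx⟩ hx'
    obtain ⟨f, rfl⟩ := V.mkQ_surjective x
    have hx'' : φC (V.mkQ f) = 0 := congrArg Subtype.val hx'
    obtain ⟨g, hg⟩ := h₁ f ((hv0 f).1 hx) ((hφ0 f).1 hx'')
    exact (Submodule.Quotient.mk_eq_zero V).2 ⟨g, hg.symm⟩
  obtain ⟨σ, hσ'⟩ := exists_comp_eq_of_ker_le hε hker
  have hσ (x : H) : σ (ε x) = θC x := LinearMap.congr_fun hσ' x
  have hp : p ∘ₗ θC = p := by
    simp only [p]
    rw [LinearMap.comp_assoc, hφθ]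
  have hpε (x : H) : p x = ε x := LinearMap.congr_fun hρ (ε x)
  have hpσ : p ∘ₗ σ = LinearMap.id := by
    ext1 y
    obtain ⟨x, rfl⟩ := hε y
    rw [LinearMap.comp_apply, hσ, ← LinearMap.comp_apply, hp, hpε, LinearMap.id_apply]
  have hvσ : v ∘ₗ σ = 0 := by
    ext1 y
    obtain ⟨x, rfl⟩ := hε y
    rw [LinearMap.comp_apply, hσ, ← LinearMap.comp_apply, ← hvθ, LinearMap.comp_apply,
      LinearMap.mem_ker.1 x.2, map_zero, LinearMap.zero_apply]
  have hkerv : LinearMap.ker v ≤ LinearMap.ker (θC - σ ∘ₗ p) := fun x hx => by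
    rw [LinearMap.mem_ker, LinearMap.sub_apply, LinearMap.comp_apply, hpε ⟨x, hx⟩, hσ, sub_self]
  obtain ⟨ω, hω'⟩ := exists_comp_eq_of_ker_le hv hkerv
  have hω : θC = σ ∘ₗ p + ω ∘ₗ v := by rw [hω', add_sub_cancel]
  obtain ⟨T, s, hTs⟩ := exists_fixed_shift (ι := V.subtype) (q := V.mkQ) (θL := postcomp _ θ.1)
    (θV := rangeEnd d₀ θ.1) (θC := θC) (θV' := rangeEnd d₁ θ.1)
    (Submodule.injective_subtype V) (LinearMap.exact_subtype_mkQ V) V.mkQ_surjective hL rfl rfl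
    hv hvθ hp hpσ hvσ hω i
  have hUnt : Nontrivial U := by
    obtain ⟨f, hf, hf'⟩ := h₂
    refine ⟨⟨⟨φC (V.mkQ f), Submodule.mem_map_of_mem ((hv0 f).2 hf)⟩, 0, fun h => hf' ?_⟩⟩
    exact (hφ0 f).1 (congrArg Subtype.val h)
  obtain ⟨a, r, har⟩ := exists_residueField_retract (R := R) (U := U) (by
    rintro a ha ⟨x, hx⟩
    obtain ⟨f, rfl⟩ := Vk.mkQ_surjective x
    have haf : a • f = 0 := by
      refine LinearMap.ext fun y => ?_
      obtain ⟨z, hz⟩ := Submodule.mkQ_surjective _ (f y)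
      rw [LinearMap.smul_apply, ← hz, ← map_smul, LinearMap.zero_apply]
      exact (Submodule.Quotient.mk_eq_zero _).2 (Ideal.mul_mem_right _ _ ha)
    refine Subtype.ext ?_
    change a • Vk.mkQ f = 0
    rw [← map_smul, haf, map_zero])
  refine ⟨T, s ∘ₗ ModExt.map R r (i + 2), fun b x hbx => ?_⟩
  obtain ⟨hb, hx⟩ := hTs b _ hbx
  refine ⟨hb, ?_⟩
  rw [← ModExt.map_id (i + 2) x, ← har, ModExt.map_comp, hx, map_zero]

end

/-! ### Nonfree syzygies and the conclusion. -/

section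

variable {R : Type u} [CommRing R]

/-- Lift `h` through `φ` and subtract: the difference takes values in `ker φ`, and the class
obstructing its extension to `P` lies in `Ext^1(X, ker φ)`, which `θ` annihilates. -/
lemma EndOver.Kills.exists_lift {B k X Y P : Type u} [AddCommGroup B] [Module R B]
    [AddCommGroup k] [Module R k] [AddCommGroup X] [Module R X] [AddCommGroup Y] [Module R Y]
    [AddCommGroup P] [Module R P] [Module.Projective R P] {φ : B →ₗ[R] k} {θ : EndOver φ}
    (hφ : Surjective φ) (hθ : θ.Kills X) {ι : Y →ₗ[R] P} {π : P →ₗ[R] X} (hι : Injective ι)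
    (hex : Exact ι π) (hπ : Surjective π) (f : Y →ₗ[R] B) (h : P →ₗ[R] k)
    (hf : φ ∘ₗ f = h ∘ₗ ι) : ∃ g : P →ₗ[R] B, θ.1 ∘ₗ f = g ∘ₗ ι := by
  obtain ⟨h', rfl⟩ := Module.projective_lifting_property φ h hφ
  let f' : Y →ₗ[R] LinearMap.ker φ := (f - h' ∘ₗ ι).codRestrict _ fun y => by
    rw [LinearMap.mem_ker, LinearMap.sub_apply, map_sub, sub_eq_zero]
    exact LinearMap.congr_fun hf y
  obtain ⟨g, hg⟩ := ModExt.exists_extension hι hex hπ (θ.onKer ∘ₗ f') (by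
    rw [← ModExt.mapRight_ofLin, ModExt.δ_mapRight, hθ])
  refine ⟨(LinearMap.ker φ).subtype ∘ₗ g + θ.1 ∘ₗ h', ?_⟩
  ext y
  have h1 : (g (ι y) : B) = θ.1 (f y - h' (ι y)) := congrArg Subtype.val (LinearMap.congr_fun hg y)
  simp [h1]

variable [IsLocalRing R] [IsNoetherianRing R]

/-- If every map from `Y` to the residue field extended to `P`, then `ι` would stay injective after
tensoring with that field, forcing `X` to be free. -/
lemma exists_map_not_extending {X Y P : Type u} [AddCommGroup X] [Module R X] [AddCommGroup Y]
    [Module R Y] [AddCommGroup P] [Module R P] [Module.Finite R P] [Module.Free R P]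
    {ι : Y →ₗ[R] P} {π : P →ₗ[R] X} (hι : Injective ι) (hex : Exact ι π) (hπ : Surjective π)
    (hX : ¬ Module.Free R X) :
    ∃ f : Y →ₗ[R] (R ⧸ IsLocalRing.maximalIdeal R),
      ¬ ∃ g : P →ₗ[R] (R ⧸ IsLocalRing.maximalIdeal R), f = g ∘ₗ ι := by
  by_contra! H
  refine hX ?_
  have : Module.Finite R Y := Module.Finite.of_injective ι hι
  refine Module.free_of_lTensor_residueField_injective ι π hπ hex ?_
  let k := IsLocalRing.ResidueField R
  rw [injective_iff_map_eq_zero]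
  intro z hz
  by_contra hz0
  obtain ⟨lam, hlam⟩ : ∃ lam : TensorProduct R k Y →ₗ[k] k, lam z ≠ 0 := by
    by_contra! h
    exact hz0 ((Module.forall_dual_apply_eq_zero_iff k z).1 h)
  obtain ⟨g, hg⟩ := H (lam.restrictScalars R ∘ₗ TensorProduct.mk R k Y 1)
  let g' : TensorProduct R k P →ₗ[R] k :=
    TensorProduct.lift ((LinearMap.mul R k).compl₂ g)
  have key : g' ∘ₗ ι.lTensor k = lam.restrictScalars R := by
    refine TensorProduct.ext' fun a y => ?_
    have h1 : g (ι y) = lam (1 ⊗ₜ y) := (LinearMap.congr_fun hg y).symm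
    have h2 : (a ⊗ₜ[R] y : TensorProduct R k Y) = a • (1 ⊗ₜ[R] y) := by
      rw [TensorProduct.smul_tmul', smul_eq_mul, mul_one]
    rw [LinearMap.restrictScalars_apply, h2, LinearMap.map_smul lam, ← h1, ← h2]
    rfl
  refine hlam ?_
  have := LinearMap.congr_fun key z
  rw [LinearMap.comp_apply, hz, map_zero] at this
  exact this.symm

/-- As `Ext^1(X, R) = 0`, the coordinate functionals of `Y` extend to `P` and assemble to a
retraction of `ι`. -/
lemma free_of_free_syzygy {X Y P : Type u} [AddCommGroup X] [Module R X] [AddCommGroup Y]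
    [Module R Y] [AddCommGroup P] [Module R P] [Module.Finite R P] [Module.Free R P]
    {ι : Y →ₗ[R] P} {π : P →ₗ[R] X} (hι : Injective ι) (hex : Exact ι π) (hπ : Surjective π)
    (hX : ExtVanishing R X) [Module.Free R Y] : Module.Free R X := by
  have : Module.Finite R Y := Module.Finite.of_injective ι hι
  let b := Module.Free.chooseBasis R Y
  choose g hg using fun i => hX.dualMap_surjective hι hex hπ (b.coord i)
  refine Module.free_of_lTensor_residueField_injective ι π hπ hex
    ((IsLocalRing.split_injective_iff_lTensor_residueField_injective ι).1
      ⟨∑ i, (g i).smulRight (b i), ?_⟩)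
  ext y
  simp only [LinearMap.comp_apply, LinearMap.sum_apply, LinearMap.smulRight_apply,
    LinearMap.id_apply]
  conv_rhs => rw [← b.sum_repr y]
  exact Finset.sum_congr rfl fun i _ => by
    rw [show g i (ι y) = b.repr y i from LinearMap.congr_fun (hg i) y]

/-- A module of Gorenstein dimension zero that is not free has a free resolution all of whose
syzygies are of this kind. -/
lemma exists_nonfree_resolution {M : Type u} [AddCommGroup M] [Module R M]
    (hM : IsGorensteinProjective R M) (hM' : ¬ Module.Free R M) :
    ∃ (X : ℕ → ModuleCat.{u} R) (n : ℕ → ℕ) (ι : ∀ j, X (j + 1) →ₗ[R] (Fin (n j) → R))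
      (π : ∀ j, (Fin (n j) → R) →ₗ[R] X j),
      ∀ j, IsGorensteinProjective R (X j) ∧ ¬ Module.Free R (X j) ∧ Injective (ι j) ∧
        Exact (ι j) (π j) ∧ Surjective (π j) := by
  let S := {N : ModuleCat.{u} R // IsGorensteinProjective R N ∧ ¬ Module.Free R N}
  have step (s : S) : ∃ t : S, IsSyzygy R t.1 s.1 := by
    obtain ⟨n, π, hπ, hK⟩ := s.2.1.exists_syzygy
    have hex := LinearMap.exact_subtype_ker_map π
    refine ⟨⟨ModuleCat.of R (LinearMap.ker π), hK, fun hfree => s.2.2 ?_⟩, n,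
      (LinearMap.ker π).subtype, π, Submodule.injective_subtype _, hex, hπ⟩
    have : Module.Free R (LinearMap.ker π) := hfree
    exact free_of_free_syzygy (Submodule.injective_subtype _) hex hπ s.2.1.ext
  choose next hnext using step
  let X : ℕ → S := fun j => Nat.rec ⟨ModuleCat.of R M, hM, hM'⟩ (fun _ s => next s) j
  have hX (j : ℕ) : IsSyzygy R (X (j + 1)).1 (X j).1 := hnext (X j)
  choose n ι π h using hX
  exact ⟨fun j => (X j).1, n, ι, π, fun j => ⟨(X j).2.1, (X j).2.2, h j⟩⟩

theorem isGorensteinLocal_of_not_free (hfin : (indecTotallyReflexiveClasses R).Finite)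
    {M : Type u} [AddCommGroup M] [Module R M] (hM : IsGorensteinProjective R M)
    (hM' : ¬ Module.Free R M) : IsGorensteinLocal R := by
  obtain ⟨X, n, ι, π, h⟩ := exists_nonfree_resolution hM hM'
  obtain ⟨B, φ, hB, hφ⟩ := exists_precover hfin (R ⧸ IsLocalRing.maximalIdeal R)
  obtain ⟨θ, hθ⟩ := EndOver.exists_kills_all hfin hφ hB
  have hφs : Surjective φ := by
    obtain ⟨g, hg⟩ := hφ R .of_free (IsLocalRing.maximalIdeal R).mkQ
    have := Submodule.mkQ_surjective (IsLocalRing.maximalIdeal R)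
    intro y
    obtain ⟨x, rfl⟩ := this y
    exact ⟨g x, LinearMap.congr_fun hg x⟩
  let d (j : ℕ) : (Fin (n (j + 1)) → R) →ₗ[R] (Fin (n j) → R) := ι j ∘ₗ π (j + 1)
  have hdd (j : ℕ) : d j ∘ₗ d (j + 1) = 0 := by
    refine LinearMap.ext fun x => ?_
    simp only [d, LinearMap.comp_apply, (h (j + 1)).2.2.2.1.apply_apply_eq_zero, map_zero,
      LinearMap.zero_apply]
  have factor (j : ℕ) (f : (Fin (n (j + 1)) → R) →ₗ[R] B) (hf : f ∘ₗ d (j + 1) = 0) :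
      ∃ g : X (j + 1) →ₗ[R] B, f = g ∘ₗ π (j + 1) := by
    obtain ⟨-, -, -, hex, hs⟩ := h (j + 1)
    have hker : LinearMap.ker (π (j + 1)) ≤ LinearMap.ker f := fun x hx => by
      obtain ⟨y, rfl⟩ := (hex x).1 hx
      obtain ⟨w, rfl⟩ := (h (j + 1 + 1)).2.2.2.2 y
      exact LinearMap.congr_fun hf w
    obtain ⟨g, hg⟩ := exists_comp_eq_of_ker_le hs hker
    exact ⟨g, hg.symm⟩
  -- The cohomological degree is set equal to the position `j`, so that the source of each map `T`
  -- is the target of the next.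
  have shift (j : ℕ) := exists_fixed_shift_hom (hdd j) θ
    ((hB.ext.pi (n (j + 1))).of_equiv ((Pi.basisFun R (Fin (n (j + 1)))).constr R (M' := B)).symm)
    (by
      rintro f hf ⟨l, hl⟩
      obtain ⟨g, rfl⟩ := factor j f hf
      obtain ⟨hG, -, hi, hex, hs⟩ := h j
      have hgl : φ ∘ₗ g = l ∘ₗ ι j := by
        refine LinearMap.ext fun y => ?_
        obtain ⟨w, rfl⟩ := (h (j + 1)).2.2.2.2 y
        exact LinearMap.congr_fun hl w
      obtain ⟨g', hg'⟩ := (hθ _ hG).exists_lift hφs hi hex hs g l hgl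
      refine ⟨g', ?_⟩
      rw [← LinearMap.comp_assoc, hg', LinearMap.comp_assoc])
    (by
      obtain ⟨hG, hfree, hi, hex, hs⟩ := h j
      obtain ⟨f, hf⟩ := exists_map_not_extending hi hex hs hfree
      obtain ⟨g, rfl⟩ := hφ _ (h (j + 1)).1 f
      refine ⟨g ∘ₗ π (j + 1), LinearMap.ext fun x => ?_, ?_⟩
      · simp only [d, LinearMap.comp_apply, (h (j + 1)).2.2.2.1.apply_apply_eq_zero, map_zero,
          LinearMap.zero_apply]
      · rintro ⟨l, hl⟩
        refine hf ⟨l, LinearMap.ext fun y => ?_⟩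
        obtain ⟨w, rfl⟩ := (h (j + 1)).2.2.2.2 y
        exact LinearMap.congr_fun hl w) j
  choose T s hTs using shift
  -- Finiteness of `B` makes the fixed part of `Ext^1` at position `0` noetherian.
  have := hB.finite
  obtain ⟨N, hN⟩ := eventually_subsingleton_of_injective_chain
    (fun j => ModExt.fixed (rangeEnd (d j) θ.1) (j + 1))
    (fun j => ModExt R (R ⧸ IsLocalRing.maximalIdeal R) R (j + 2)) T s hTs
  refine isGorensteinLocal_of_ext_residueField (n := N + 2) fun i hi => ?_
  obtain ⟨j, rfl⟩ : ∃ j, i = j + 2 := ⟨i - 2, by omega⟩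
  exact hN j (by omega)

end

theorem theorem4p3 (R : Type u) [CommRing R] [IsLocalRing R] [IsNoetherianRing R]
    (hfin : (indecTotallyReflexiveClasses R).Finite) :
    IsGorensteinLocal R ∨
      ∀ (M : Type u) [AddCommGroup M] [Module R M],
        IsTotallyReflexive R M ↔ (Module.Finite R M ∧ Module.Free R M) := by
  by_cases hG : IsGorensteinLocal R
  · exact Or.inl hG
  · refine Or.inr fun M _ _ => ⟨fun hM => ?_, fun ⟨_, _⟩ => ?_⟩
    · have hM' := hM.isGorensteinProjective
      exact ⟨hM'.finite, by_contra fun h => hG (isGorensteinLocal_of_not_free hfin hM' h)⟩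
    · exact IsGorensteinProjective.of_free.isTotallyReflexive
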